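/- Let $F$ be the algebraic closure of a finite field. Let $A'$ be the free associative (noncommutative, without identity) $F$-algebra on generators $a,b,x$, and let $A'^{1}$ be $A'$ with an identity adjoined. Grade $A'$ by giving $a$ and $b$ degree $1$ and $x$ degree $0$. Subalgebras are not required to contain an identity. Let $R$ be the subalgebra of $A'$ generated by $a$ and $b$; let $A$ be the subalgebra generated by all $ax^{i},bx^{i}$ $(i\ge 0)$; let $A^{*}\subseteq A$ be the subalgebra generated by all $ax^{i}ax^{j}$ and $bx^{i}bx^{j}$ $(i,j\ge 0)$; and let $A^{*}(j)$ be the space of elements of $A^{*}$ that are homogeneous of degree $j$. Let $\langle x\rangle$ be the ideal of $A'$ generated by $x$. For $t\in F$ let $\gamma_t:A'\to A'^{1}$ be the $F$-algebra homomorphism with $\gamma_t(a)=a$, $\gamma_t(b)=b$, $\gamma_t(x)=x+t$, and apply it entrywise to matrices. For a square matrix $N$ over $A'$ let $L(N)$ be the $F$-linear span of the matrices $\gamma_t(N)$, $t\in F$, and let $S(L(N))$ be the $F$-linear span of all entries of all matrices in $L(N)$. **Theorem.** Let $M$ be a square matrix (of any finite size) with entries in $A^{*}(j)$ for some $j$,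 such that for all but finitely many natural numbers $\alpha$ the matrix $M^{\alpha}$ has all its entries in $\langle x\rangle$. Then there are infinitely many $n$ such that the $F$-vector space $R\cap S(L(M^{n}))$ is finite dimensional with $$\dim_F\bigl(R\cap S(L(M^{n}))\bigr)\le\sqrt{n}.$$ -/

import Mathlib

namespace PlatinumAlgebra

/-- The three free generators `a`, `b`, `x`. -/
inductive Gen : Type
  | a
  | b
  | x

/-- The unital free associative `F`-algebra on `a`, `b`, `x`. The free algebra without identity on
the same generators is its augmentation ideal. -/
abbrev Free (F : Type*) [Field F] : Type _ := FreeAlgebra F Gen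

section

variable (F : Type*) [Field F]

/-- The generator `a`. -/
def genA : Free F := FreeAlgebra.ι F Gen.a

/-- The generator `b`. -/
def genB : Free F := FreeAlgebra.ι F Gen.b

/-- The generator `x`. -/
def genX : Free F := FreeAlgebra.ι F Gen.x

/-- `R`: the subalgebra (without identity) generated by `a` and `b`. -/
def algR : NonUnitalSubalgebra F (Free F) :=
  NonUnitalAlgebra.adjoin F {genA F, genB F}

/-- `A`: the subalgebra (without identity) generated by all `a x ^ i` and `b x ^ i`. -/
def algA : NonUnitalSubalgebra F (Free F) :=
  NonUnitalAlgebra.adjoin F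
    (Set.range (fun i : ℕ => genA F * genX F ^ i) ∪ Set.range (fun i : ℕ => genB F * genX F ^ i))

/-- `A^*`: the subalgebra (without identity) generated by all `a x ^ i a x ^ j` and
`b x ^ i b x ^ j`. -/
def algAStar : NonUnitalSubalgebra F (Free F) :=
  NonUnitalAlgebra.adjoin F
    (Set.range (fun p : ℕ × ℕ => genA F * genX F ^ p.1 * (genA F * genX F ^ p.2)) ∪
      Set.range (fun p : ℕ × ℕ => genB F * genX F ^ p.1 * (genB F * genX F ^ p.2)))

/-- `A^*` is a subalgebra of `A`. -/
theorem algAStar_le_algA : algAStar F ≤ algA F := by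
  refine NonUnitalAlgebra.adjoin_le ?_
  rintro y (⟨p, rfl⟩ | ⟨p, rfl⟩)
  · exact mul_mem (NonUnitalAlgebra.subset_adjoin F (Or.inl ⟨p.1, rfl⟩))
      (NonUnitalAlgebra.subset_adjoin F (Or.inl ⟨p.2, rfl⟩))
  · exact mul_mem (NonUnitalAlgebra.subset_adjoin F (Or.inr ⟨p.1, rfl⟩))
      (NonUnitalAlgebra.subset_adjoin F (Or.inr ⟨p.2, rfl⟩))

/-- `<x>`: the two-sided ideal generated by `x`. -/
def idealX : TwoSidedIdeal (Free F) := TwoSidedIdeal.span {genX F}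

end

/-- The gradation of a generator: `a` and `b` have gradation `1`, `x` has gradation `0`. -/
def Gen.weight : Gen → ℕ
  | Gen.a => 1
  | Gen.b => 1
  | Gen.x => 0

section

variable (F : Type*) [Field F]

/-- The linear space spanned by all monomials of gradation `n`. -/
def homogeneousPart (n : ℕ) : Submodule F (Free F) :=
  Submodule.span F
    {y | ∃ w : List Gen, (w.map Gen.weight).sum = n ∧ y = (w.map (FreeAlgebra.ι F)).prod}

/-- `A^*(j)`: the elements of `A^*` that are homogeneous of gradation `j`. -/
def algAStarPart (j : ℕ) : Submodule F (Free F) :=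
  (algAStar F).toSubmodule ⊓ homogeneousPart F j

end

section

variable {F : Type*} [Field F]

/-- `γ_t`: the homomorphism of algebras with `a ↦ a`, `b ↦ b`, `x ↦ x + t`. -/
def gamma (t : F) : Free F →ₐ[F] Free F :=
  FreeAlgebra.lift F (fun g : Gen => match g with
    | Gen.a => genA F
    | Gen.b => genB F
    | Gen.x => genX F + algebraMap F (Free F) t)

/-- `L(M)`: the linear space of matrices spanned by the matrices `γ_t(M)` (entrywise), `t ∈ F`. -/
def matrixL {d : ℕ} (M : Matrix (Fin d) (Fin d) (Free F)) :
    Submodule F (Matrix (Fin d) (Fin d) (Free F)) :=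
  Submodule.span F (Set.range fun t : F => M.map (gamma t))

/-- `S(T)`: the linear space spanned by all entries of all matrices in `T`. -/
def entrySpan {d : ℕ} (T : Submodule F (Matrix (Fin d) (Fin d) (Free F))) :
    Submodule F (Free F) :=
  Submodule.span F {y | ∃ N ∈ T, ∃ k l : Fin d, y = N k l}

end

end PlatinumAlgebra

/-! Substituting a scalar `s` for `x` turns `M` into the sum of `P_v(s) v` over words `v` of length
`j`, with matrices `P_v` over `F[X]`. No monomial of an entry begins with `x`, so in `M ^ N` each of
the `N` factors can be given its own scalar `s i` (`shiftAction`). An element `f` of `R` contains no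
`x` and does not notice these choices. If also `f ∈ S(L(M ^ N))`, its coefficient at `v_1 ⋯ v_N` is
the value of a fixed linear functional at the product of the `P_{v_i}(X + s i)`, whatever the `s i`.
So the functional kills differences of such products. With `B` the span of all `P_v(X + s)` and `D`
the span of all `P_v(X + s) - P_v(X + t)`, it kills `mixedPow B D N`, and the dimension sought is at
most the codimension of `mixedPow B D N` in `B ^ N` (`finrank_inf_entrySpan_le`).

It remains to bound this codimension by a constant `r` for infinitely many `N`
(`exists_bounded_codim_shiftSpan`); then `N ≥ r ^ 2` suffices. Degrees show that `dim B ^ N` grows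
at most linearly. Over `k = F(X)`, `B` spans the space `𝒲` of all coefficient matrices of the `P_v`.
Their entries lie in a finite ring, so some power of `𝒲` is idempotent. `D` yields all coefficients
except the constant ones, which generate a nilpotent algebra because `M ^ α` lies in `⟨x⟩`. Hence,
after passing to `B ^ g` and `mixedPow B D g`, all powers of `D` have the same `k`-span `𝒜`.

Among the powers of `D`, take a matrix whose eigenvalue `0` has least multiplicity, and let `e` be
its Fitting idempotent. Minimality makes the corners of `𝒜` at `1 - e` nilpotent, so `{y ∈ 𝒜 | e y =
0}` is nilpotent (`exists_fitting_identity`). Now peel factors off `B ^ N` (`exists_gluing`). The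
`e`-part is absorbed by `c B ^ i`, which lies in `mixedPow`, where `c` is a power of the chosen
matrix; the loss is bounded in a window where `dim e B ^ i` grows slowly. The `(1 - e)`-part moves
one step deeper into the nilpotent space, and after boundedly many steps it is gone. -/

namespace PlatinumAlgebra

open Polynomial

/-! ### Nil algebras and the Jacobson radical. -/

/-- A finite-dimensional nil algebra is nilpotent. -/
theorem exists_pow_eq_bot_of_nil {k A : Type*} [Field k] [Ring A] [Algebra k A]
    [FiniteDimensional k A] (S : Submodule k A) (hmul : S * S ≤ S)
    (hnil : ∀ x ∈ S, IsNilpotent x) : ∃ L : ℕ, S ^ L = ⊥ := by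
  let U : Subalgebra k A := Algebra.adjoin k (S : Set A)
  have hU : ∀ y ∈ U, ∀ x ∈ S, y * x ∈ S := by
    intro y hy
    induction hy using Algebra.adjoin_induction with
    | mem y hy => exact fun x hx => hmul (Submodule.mul_mem_mul hy hx)
    | algebraMap r =>
      intro x hx
      rw [← Algebra.smul_def]
      exact S.smul_mem r hx
    | add y z _ _ hy hz =>
      intro x hx
      rw [add_mul]
      exact S.add_mem (hy x hx) (hz x hx)
    | mul y z _ _ hy hz =>
      intro x hx
      rw [mul_assoc]
      exact hy _ (hz x hx)
  have hSU : ∀ x ∈ S, x ∈ U := fun x hx => Algebra.subset_adjoin hx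
  have : IsArtinianRing U := IsArtinianRing.of_finite k U
  obtain ⟨L, hL⟩ := IsArtinianRing.isNilpotent_jacobson_bot (R := U)
  -- `S` is a nil left ideal of the unital algebra `U` that it generates, so `y x + 1` is always a
  -- unit.
  have hJ : ∀ x (hx : x ∈ S), (⟨x, hSU x hx⟩ : U) ∈ (⊥ : Ideal U).jacobson := by
    intro x hx
    rw [Ideal.mem_jacobson_iff]
    intro y
    have hn : IsNilpotent (y * ⟨x, hSU x hx⟩ : U) := by
      obtain ⟨n, hn⟩ := hnil _ (hU y y.2 x hx)
      exact ⟨n, Subtype.ext (by simpa using hn)⟩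
    obtain ⟨u, hu⟩ := hn.isUnit_add_one
    refine ⟨(u⁻¹ : Uˣ), ?_⟩
    have : (u⁻¹ : Uˣ) * y * (⟨x, hSU x hx⟩ : U) + (u⁻¹ : Uˣ) - 1
        = (u⁻¹ : Uˣ) * (y * ⟨x, hSU x hx⟩ + 1) - 1 := by
      rw [mul_add, mul_one, mul_assoc]
    rw [this, ← hu]
    simp
  refine ⟨L, ?_⟩
  have key : ∀ n : ℕ, ∀ x ∈ S ^ n, ∃ hx : x ∈ U, (⟨x, hx⟩ : U) ∈ (⊥ : Ideal U).jacobson ^ n := by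
    intro n
    induction n with
    | zero =>
      intro x hx
      rw [pow_zero] at hx
      obtain ⟨r, rfl⟩ := Submodule.mem_one.1 hx
      refine ⟨U.algebraMap_mem r, ?_⟩
      rw [Submodule.pow_zero, Ideal.one_eq_top]
      trivial
    | succ n ih =>
      intro x hx
      rw [pow_succ] at hx
      induction hx using Submodule.mul_induction_on' with
      | mem_mul_mem a ha b hb =>
        obtain ⟨h1, h2⟩ := ih a ha
        refine ⟨U.mul_mem h1 (hSU b hb), ?_⟩
        rw [Submodule.pow_succ]
        exact Ideal.mul_mem_mul h2 (hJ b hb)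
      | add a _ b _ ha hb =>
        obtain ⟨h1, h2⟩ := ha
        obtain ⟨h3, h4⟩ := hb
        exact ⟨U.add_mem h1 h3, Ideal.add_mem _ h2 h4⟩
  rw [eq_bot_iff]
  intro x hx
  obtain ⟨hx', h⟩ := key L x hx
  rw [hL] at h
  have := congrArg Subtype.val (show (⟨x, hx'⟩ : U) = 0 by simpa using h)
  simpa using this

/-! ### Fitting idempotents, and nilpotency along lines of matrices. -/

section Fitting

variable {k : Type*} [Field k] {n : Type*} [Fintype n] [DecidableEq n]

/-- The Fitting idempotent of a matrix. -/
theorem exists_fitting (A : Matrix n n k) :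
    ∃ (N : ℕ) (q r : k[X]), 1 ≤ N ∧
      aeval A (X * q) * aeval A (X * q) = aeval A (X * q) ∧
      A ^ N * aeval A (X * q) = A ^ N ∧ aeval A r * A ^ N = aeval A (X * q) ∧
      aeval A r * aeval A (X * q) = aeval A r := by
  have h0 : A.charpoly ≠ 0 := A.charpoly_monic.ne_zero
  obtain ⟨g, hg, hg'⟩ := exists_eq_pow_rootMultiplicity_mul_and_not_dvd A.charpoly h0 0
  rw [C_0, sub_zero] at hg hg'
  set s := rootMultiplicity 0 A.charpoly
  have hc : IsCoprime (X ^ (s + 1)) g :=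
    IsCoprime.pow_left ((irreducible_X.coprime_iff_not_dvd).2 hg')
  obtain ⟨u, w, huw⟩ := hc
  have hA : aeval A (X ^ s * g) = 0 := by
    rw [← hg]; exact Matrix.aeval_self_charpoly A
  have hz : ∀ p : k[X], aeval A (p * (X ^ s * g)) = 0 := fun p => by
    rw [map_mul, hA, mul_zero]
  have heq : ∀ p p' c : k[X], p = p' + c * (X ^ s * g) → aeval A p = aeval A p' := by
    rintro p p' c rfl
    rw [map_add, hz, add_zero]
  have hw : w * g = 1 - u * X ^ (s + 1) := by rw [← huw]; ring
  have h1 : (X * (u * X ^ s) : k[X]) * (X * (u * X ^ s)) =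
      X * (u * X ^ s) + (-(u * X * w)) * (X ^ s * g) := by
    linear_combination (u * X ^ (s + 1)) * hw
  -- The idempotent is `u X ^ (s + 1)` at `A`: it is `1` modulo `g` and `0` modulo `X ^ s`. The
  -- exponent `s + 1` instead of `s` makes it a multiple of `X` even when `s = 0`.
  refine ⟨s + 1, u * X ^ s, u * (X * (u * X ^ s)), by omega, ?_, ?_, ?_, ?_⟩
  · rw [← map_mul]
    exact heq _ _ _ h1
  · have := heq (X ^ (s + 1) * (X * (u * X ^ s))) (X ^ (s + 1)) (-(X * w))
      (by linear_combination (X ^ (s + 1)) * hw)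
    simpa only [map_mul, map_pow, aeval_X] using this
  · have := heq (u * (X * (u * X ^ s)) * X ^ (s + 1)) (X * (u * X ^ s)) (-(u * X * w))
      (by linear_combination h1)
    simpa only [map_mul, map_pow, aeval_X] using this
  · have := heq (u * (X * (u * X ^ s)) * (X * (u * X ^ s))) (u * (X * (u * X ^ s)))
      (u * (-(u * X * w))) (by linear_combination u * h1)
    simpa only [map_mul, map_pow, aeval_X] using this

/-- Divisibility of a determinant by a power of `X` along a line of matrices is decided by
infinitely many points of the line. -/
theorem X_pow_dvd_det_of_infinite (A B : Matrix n n k[X]) (s : ℕ) (T : Set k) (hT : T.Infinite)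
    (h : ∀ c ∈ T, X ^ s ∣ (A + C c • B).det) (c : k) : X ^ s ∣ (A + C c • B).det := by
  let M : Matrix n n k[X][X] := A.map C + (X : k[X][X]) • B.map C
  have hM : ∀ c : k, (A + C c • B).det = M.det.eval (C c) := by
    intro c
    rw [← coe_evalRingHom, RingHom.map_det]
    congr 1
    ext1 i j
    simp only [M, Matrix.add_apply, Matrix.smul_apply, Matrix.map_apply, smul_eq_mul,
      RingHom.mapMatrix_apply, coe_evalRingHom, eval_add, eval_mul, eval_X, eval_C]
  have hcoef : ∀ (c : k) (i : ℕ), ((A + C c • B).det).coeff i =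
      (∑ m ∈ M.det.support, C ((M.det.coeff m).coeff i) * X ^ m).eval c := by
    intro c i
    rw [hM, eval_eq_sum, Polynomial.sum, finsetSum_coeff, eval_finsetSum]
    refine Finset.sum_congr rfl fun m _ => ?_
    rw [← C_pow, coeff_mul_C]
    simp
  rw [X_pow_dvd_iff]
  intro i hi
  rw [hcoef]
  -- Each low coefficient of the determinant is a polynomial in the parameter `c` of the line.
  have hzero : (∑ m ∈ M.det.support, C ((M.det.coeff m).coeff i) * X ^ m : k[X]) = 0 := by
    refine eq_zero_of_infinite_isRoot _ (hT.mono fun c hc => ?_)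
    show IsRoot _ c
    rw [IsRoot, ← hcoef]
    exact X_pow_dvd_iff.1 (h c hc) i hi
  rw [hzero, eval_zero]

theorem isNilpotent_iff_X_pow_dvd_charpoly (A : Matrix n n k) :
    IsNilpotent A ↔ X ^ Fintype.card n ∣ A.charpoly := by
  constructor
  · intro h
    have := Matrix.isNilpotent_charpoly_sub_pow_of_isNilpotent h
    rw [sub_eq_zero.1 this.eq_zero]
  · intro h
    have h1 : A.charpoly = X ^ Fintype.card n := by
      refine (eq_of_monic_of_dvd_of_natDegree_le (monic_X_pow _) A.charpoly_monic h ?_)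
      rw [Matrix.charpoly_natDegree_eq_dim, natDegree_X_pow]
    refine ⟨Fintype.card n, ?_⟩
    have := Matrix.aeval_self_charpoly A
    rwa [h1, map_pow, aeval_X] at this

/-- Nilpotency along a line of matrices is decided by infinitely many points of the line. -/
theorem isNilpotent_add_smul_of_infinite (A B : Matrix n n k) (T : Set k) (hT : T.Infinite)
    (h : ∀ c ∈ T, IsNilpotent (A + c • B)) (c : k) : IsNilpotent (A + c • B) := by
  have hdet : ∀ c : k, (A + c • B).charpoly =
      (A.charmatrix + C c • (-(B.map C))).det := by
    intro c
    rw [Matrix.charpoly]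
    congr 1
    ext1 i j
    simp [Matrix.charmatrix_apply]
    ring
  rw [isNilpotent_iff_X_pow_dvd_charpoly, hdet]
  refine X_pow_dvd_det_of_infinite _ _ _ T hT (fun c hc => ?_) c
  rw [← hdet, ← isNilpotent_iff_X_pow_dvd_charpoly]
  exact h c hc

end Fitting

/-! ### Nilpotency of the corner complementary to a Fitting idempotent. -/

section Identities

variable {R A : Type*} [CommRing R] [Ring A] [Algebra R A] {e : A}

theorem idempotent_scaling_mul (he : e * e = e) (x : R) :
    (x • (1 - e) + e) * (x • e + (1 - e)) = x • (1 : A) := by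
  simp only [mul_add, add_mul, mul_sub, sub_mul, smul_mul_assoc, mul_smul_comm, he, mul_one,
    one_mul, smul_sub]
  module

theorem sub_factor_of_commute (he : e * e = e) (x : R) (a : A) (ha : a * e = e * a) :
    (x • (1 - e) + e - a * (1 - e)) * (x • e + (1 - e) - a * e) = x • (1 : A) - a := by
  have h1 : ∀ z, e * (e * z) = e * z := fun z => by rw [← mul_assoc, he]
  have h2 : a * (e * a) = e * (a * a) := by rw [← mul_assoc, ha, mul_assoc]
  have h3 : a * (a * e) = e * (a * a) := by rw [ha, h2]
  simp only [mul_add, add_mul, mul_sub, sub_mul, smul_mul_assoc, mul_smul_comm, he, mul_one,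
    one_mul, smul_sub, mul_assoc, ha, h1, h2]
  module

theorem sub_factor_of_commute' (he : e * e = e) (x : R) (a : A) (ha : a * e = e * a) :
    (x • (1 - e) + e - a * (1 - e)) * (x • e + (1 - e)) = x • (1 : A) - a * (1 - e) := by
  have h1 : ∀ z, e * (e * z) = e * z := fun z => by rw [← mul_assoc, he]
  simp only [mul_add, add_mul, mul_sub, sub_mul, smul_mul_assoc, mul_smul_comm, he, mul_one,
    one_mul, smul_sub, mul_assoc, ha, h1]
  module

/-- On determinants, this expresses the characteristic polynomial of the corner through the third
factor, which is the limit of the pencil in `pencil_factor`. -/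
theorem corner_factor (he : e * e = e) (x : R) (c ci y : A) (hec : e * c = c)
    (hci : ci * c = e) (hcie : ci * e = ci) :
    (1 + (1 - e) * y * e) * ((1 - e) - ci) * ((1 - e) * (x • 1 - y) - c) * (x • e + (1 - e)) =
      x • (1 : A) - (1 - e) * y * (1 - e) := by
  have h1 : ((1 - e) - ci) * ((1 - e) * (x • 1 - y) - c) = (1 - e) * (x • 1 - y) + e := by
    have : (1 - e) * (1 - e) = 1 - e := by simp [mul_sub, sub_mul, he]
    have h2 : ((1 - e) - ci) * (1 - e) = 1 - e := by rw [sub_mul, this, mul_sub, hcie]; simp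
    have h3 : ((1 - e) - ci) * c = - e := by rw [sub_mul, hci, sub_mul, hec]; simp
    rw [mul_sub, ← mul_assoc, h2, h3, sub_neg_eq_add]
  have h4 : ((1 - e) * (x • 1 - y) + e) * (x • e + (1 - e)) =
      x • (1 : A) - (1 - e) * y * (1 - e) - x • ((1 - e) * y * e) := by
    simp only [mul_add, add_mul, mul_sub, sub_mul, smul_mul_assoc, mul_smul_comm, he, mul_one,
      one_mul, smul_sub, mul_assoc]
    module
  have h5 : e * (1 - e) = 0 := by rw [mul_sub, he]; simp
  rw [mul_assoc (1 + (1 - e) * y * e), h1, mul_assoc, h4, add_mul, one_mul]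
  have h6 : (1 - e) * y * e * (x • (1 : A) - (1 - e) * y * (1 - e) - x • ((1 - e) * y * e)) =
      x • ((1 - e) * y * e) := by
    rw [mul_sub, mul_sub, mul_smul_comm, mul_smul_comm, mul_one, mul_assoc (1 - e) y e,
      mul_assoc (1 - e) (y * e), mul_assoc y e, ← mul_assoc e ((1 - e) * y) (1 - e),
      ← mul_assoc e (1 - e) y, h5]
    rw [mul_assoc (1 - e) (y * e), mul_assoc y e, ← mul_assoc e (1 - e), h5]
    simp
  rw [h6]
  module

/-- A change of parameter from `ν` to `m = 1 / ν`: the right-hand side still makes sense at `m = 0`,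
that is, at `ν = ∞`. -/
theorem pencil_factor (x m ν : R) (hν : m * ν = 1) (c y : A) (hec : e * c = c) :
    (m • e + (1 - e)) * (x • 1 - (y + ν • c)) =
      ((1 - e) * (x • 1 - y) - c) + m • (e * (x • 1 - y)) := by
  have h : (m • e + (1 - e)) * (ν • c) = c := by
    rw [mul_smul_comm, add_mul, smul_mul_assoc, hec, sub_mul, hec, one_mul, sub_self, add_zero,
      smul_smul, mul_comm ν, hν, one_smul]
  rw [← sub_sub, mul_sub, h, add_mul, smul_mul_assoc]
  abel

end Identities

section Corner

variable {k : Type*} [Field k] {n : Type*} [Fintype n] [DecidableEq n]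

/-- If the order of vanishing at `0` of the characteristic polynomials of the pencil `Y + ν c` is
at least that of `A`, where `c` is a power of `A` with Fitting idempotent `e`, then the complementary
corner of `Y` is nilpotent. -/
theorem isNilpotent_corner {A c ci e Y : Matrix n n k} {s : ℕ} (he : e * e = e)
    (hec : e * c = c) (hci : ci * c = e) (hcie : ci * e = ci)
    (hA : A * e = e * A) (hnil : IsNilpotent (A * (1 - e)))
    (hs : ¬ X ^ (s + 1) ∣ A.charpoly) {T : Set k} (hT : T.Infinite)
    (hY : ∀ ν ∈ T, X ^ s ∣ (Y + ν • c).charpoly) :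
    IsNilpotent ((1 - e) * Y * (1 - e)) := by
  let i : Matrix n n k →+* Matrix n n k[X] := (C : k →+* k[X]).mapMatrix
  have hchar : ∀ B : Matrix n n k, B.charpoly = ((X : k[X]) • (1 : Matrix n n k[X]) - i B).det := by
    intro B
    rw [Matrix.charpoly, Matrix.charmatrix, Matrix.smul_one_eq_diagonal]
    rfl
  have hsmul : ∀ (ν : k) (B : Matrix n n k), i (ν • B) = C ν • i B := by
    intro ν B
    ext1 a b
    simp [i]
  have hE : i e * i e = i e := by rw [← map_mul, he]
  set δ₁ : k[X] := ((X : k[X]) • (1 - i e) + i e).det with hδ₁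
  set δ₂ : k[X] := ((X : k[X]) • i e + (1 - i e)).det with hδ₂
  have hδ : δ₁ * δ₂ = X ^ Fintype.card n := by
    rw [← Matrix.det_mul, idempotent_scaling_mul hE, Matrix.det_smul, Matrix.det_one, mul_one]
  have hδ₂0 : δ₂ ≠ 0 := right_ne_zero_of_mul (hδ ▸ pow_ne_zero _ X_ne_zero)
  have hcomm : i A * i e = i e * i A := by rw [← map_mul, hA, map_mul]
  -- `δ₁` is, up to a unit, `X` to the rank of `1 - e`. As `A` commutes with `e` and is nilpotent on
  -- the image of `1 - e`, this power divides the characteristic polynomial.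
  have hdvd : δ₁ ∣ A.charpoly := by
    have h1 : ((X : k[X]) • (1 - i e) + i e - i A * (1 - i e)).det = δ₁ := by
      refine mul_right_cancel₀ hδ₂0 ?_
      rw [hδ, hδ₂, ← Matrix.det_mul, sub_factor_of_commute' hE _ _ hcomm]
      have := (isNilpotent_iff_X_pow_dvd_charpoly _).1 hnil
      have h2 := Matrix.isNilpotent_charpoly_sub_pow_of_isNilpotent hnil
      rw [← sub_eq_zero.1 h2.eq_zero, hchar]
      simp
    rw [hchar, ← sub_factor_of_commute hE _ _ hcomm, Matrix.det_mul, h1]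
    exact dvd_mul_right _ _
  have hδs : δ₁ ∣ X ^ s := by
    obtain ⟨m, hm, hass⟩ := (dvd_prime_pow prime_X _).1 (Dvd.intro _ hδ)
    have hms : m ≤ s := by
      by_contra hlt
      exact hs (((pow_dvd_pow X (by omega)).trans hass.symm.dvd).trans hdvd)
    exact hass.dvd.trans (pow_dvd_pow X hms)
  -- The divisibility holds at infinitely many parameters `1 / ν`, hence also at the parameter `0`.
  have hθ : X ^ s ∣ ((1 - i e) * ((X : k[X]) • 1 - i Y) - i c).det := by
    have := X_pow_dvd_det_of_infinite ((1 - i e) * ((X : k[X]) • 1 - i Y) - i c)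
      (i e * ((X : k[X]) • 1 - i Y)) s ((fun x => x⁻¹) '' (T \ {0})) ?_ ?_ 0
    · simpa using this
    · exact (hT.sdiff (Set.finite_singleton 0)).image (inv_injective.injOn)
    · rintro _ ⟨ν, ⟨hν, hν0⟩, rfl⟩
      have hν0' : ν ≠ 0 := hν0
      have hm : (C ν⁻¹ : k[X]) * C ν = 1 := by
        rw [← C_mul, inv_mul_cancel₀ hν0', C_1]
      have hec' : i e * i c = i c := by rw [← map_mul, hec]
      show _ ∣ (_ + (C ν⁻¹ : k[X]) • _ : Matrix n n k[X]).det
      rw [← pencil_factor (X : k[X]) (C ν⁻¹) (C ν) hm (i c) (i Y) hec', Matrix.det_mul,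
        ← hsmul ν c, ← map_add i, ← hchar]
      exact (hY ν hν).mul_left _
  rw [isNilpotent_iff_X_pow_dvd_charpoly, hchar, map_mul, map_mul, map_sub, map_one,
    ← corner_factor hE (X : k[X]) (i c) (i ci) (i Y)
      (by rw [← map_mul, hec]) (by rw [← map_mul, hci]) (by rw [← map_mul, hcie]),
    Matrix.det_mul, Matrix.det_mul, ← hδ]
  exact mul_dvd_mul ((hδs.trans hθ).mul_left _) dvd_rfl

end Corner

theorem aeval_mul_self_mem {k A : Type*} [Field k] [Ring A] [Algebra k A] (S : Submodule k A)
    (hS : S * S ≤ S) {x : A} (hx : x ∈ S) (p : k[X]) : aeval x (X * p) ∈ S := by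
  induction p using Polynomial.induction_on' with
  | add p q hp hq =>
    rw [mul_add, map_add]
    exact S.add_mem hp hq
  | monomial m a =>
    have h : ∀ m : ℕ, x ^ (m + 1) ∈ S := by
      intro m
      induction m with
      | zero => simpa using hx
      | succ m ih =>
        rw [pow_succ]
        exact hS (Submodule.mul_mem_mul ih hx)
    rw [← C_mul_X_pow_eq_monomial, mul_left_comm, ← pow_succ', map_mul, aeval_C, map_pow, aeval_X,
      ← Algebra.smul_def]
    exact S.smul_mem _ (h m)

/-! ### Choice of an element of least nullity in the powers of a space. -/

section Selection

variable {F k : Type*} [Field F] [Infinite F] [Field k] [Algebra F k]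
  {n : Type*} [Fintype n] [DecidableEq n]

/-- Nilpotency of corners passes from an `F`-subspace to its `k`-span. -/
theorem isNilpotent_corner_span (W : Submodule F (Matrix n n k)) (f : Matrix n n k)
    (h : ∀ Y ∈ W, IsNilpotent (f * Y * f)) {y : Matrix n n k}
    (hy : y ∈ Submodule.span k (W : Set (Matrix n n k))) : IsNilpotent (f * y * f) := by
  -- Nilpotent matrices are not closed under addition, so the induction needs a statement stable
  -- under translation by `W`: adding any `k`-multiple of `y` preserves `Z`.
  let Z : Set (Matrix n n k) := {z | ∀ Y ∈ W, IsNilpotent (f * (z + Y) * f)}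
  have hQ : ∀ c : k, ∀ z ∈ Z, c • y + z ∈ Z := by
    induction hy using Submodule.span_induction with
    | mem Y hY =>
      intro c z hz Y₀ hY₀
      have hline : ∀ c : k, f * (c • Y + z + Y₀) * f = f * (z + Y₀) * f + c • (f * Y * f) := by
        intro c
        rw [add_assoc, mul_add, add_mul, mul_smul_comm, smul_mul_assoc, add_comm]
      rw [hline]
      refine isNilpotent_add_smul_of_infinite _ _ (Set.range (algebraMap F k))
        (Set.infinite_range_of_injective (algebraMap F k).injective) ?_ c
      rintro _ ⟨a, rfl⟩
      rw [← hline, algebraMap_smul, add_assoc, add_left_comm]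
      exact hz _ (W.add_mem (W.smul_mem a hY) hY₀)
    | zero =>
      intro c z hz
      simpa using hz
    | add x y _ _ hx hy =>
      intro c z hz
      rw [smul_add, add_assoc]
      exact hx c _ (hy c z hz)
    | smul a x _ hx =>
      intro c z hz
      rw [smul_smul]
      exact hx _ z hz
  have h0 : (0 : Matrix n n k) ∈ Z := fun Y hY => by
    rw [zero_add]
    exact h Y hY
  have := hQ 1 0 h0 0 W.zero_mem
  simpa using this

/-- In the powers of a space of matrices whose powers all have the same span over the big field
there is an element whose Fitting idempotent is an identity modulo a nilpotent left ideal. -/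
theorem exists_fitting_identity (D : Submodule F (Matrix n n k)) (𝒜 : Submodule k (Matrix n n k))
    (hD : ∀ m : ℕ, 1 ≤ m → Submodule.span k ((D ^ m : Submodule F (Matrix n n k)) :
      Set (Matrix n n k)) = 𝒜) (h𝒜 : 𝒜 * 𝒜 ≤ 𝒜) :
    ∃ (m : ℕ) (c e ci : Matrix n n k) (L : ℕ), 1 ≤ m ∧ c ∈ D ^ m ∧ e ∈ 𝒜 ∧ e * c = c ∧
      ci * c = e ∧ e * e = e ∧ (𝒜 ⊓ LinearMap.ker (LinearMap.mulLeft k e)) ^ L = ⊥ := by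
  classical
  have hex : ∃ s : ℕ, ∃ m : ℕ, 1 ≤ m ∧ ∃ A ∈ D ^ m, ¬ X ^ (s + 1) ∣ A.charpoly := by
    refine ⟨(0 : Matrix n n k).charpoly.natDegree, 1, le_rfl, 0, Submodule.zero_mem _, ?_⟩
    intro h
    have := natDegree_le_of_dvd h (Matrix.charpoly_monic _).ne_zero
    rw [natDegree_X_pow] at this
    omega
  obtain ⟨m, hm, A, hA, hs⟩ := Nat.find_spec hex
  -- `s` is the least order of vanishing at `0` of a characteristic polynomial over all positive
  -- powers of `D`, attained at `A`.
  set s := Nat.find hex with hsdef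
  have hmin : ∀ m : ℕ, 1 ≤ m → ∀ Y ∈ D ^ m, X ^ s ∣ Y.charpoly := by
    intro m hm Y hY
    rcases Nat.eq_zero_or_pos s with h0 | h0
    · simp [h0]
    · have := Nat.find_min hex (m := s - 1) (by omega)
      push Not at this
      have := this m hm Y hY
      rwa [Nat.sub_add_cancel h0] at this
  obtain ⟨N, q, r, hN, he, hce, hci, hcie⟩ := exists_fitting A
  set e := aeval A (X * q)
  set ci := aeval A r
  have hAe : A * e = e * A := by
    have h := congrArg (aeval A) (mul_comm X (X * q))
    rw [map_mul, map_mul (aeval A) (X * q) X, aeval_X] at h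
    exact h
  have hec : e * A ^ N = A ^ N := by
    rw [← (show Commute A e from hAe).pow_left N, hce]
  have hmN : 1 ≤ m * N := Nat.mul_pos hm hN
  have hc : A ^ N ∈ D ^ (m * N) := by
    rw [pow_mul]
    exact Submodule.pow_mem_pow _ hA N
  have hA𝒜 : A ∈ 𝒜 := hD m hm ▸ Submodule.subset_span hA
  have he𝒜 : e ∈ 𝒜 := aeval_mul_self_mem 𝒜 h𝒜 hA𝒜 q
  have hnilA : IsNilpotent (A * (1 - e)) := by
    refine ⟨N, ?_⟩
    have hcom : Commute A (1 - e) := (Commute.one_right A).sub_right hAe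
    obtain ⟨N', rfl⟩ : ∃ N', N = N' + 1 := ⟨N - 1, by omega⟩
    rw [hcom.mul_pow, pow_succ' (1 - e), ← mul_assoc, mul_sub, hce]
    simp
  have hcorner : ∀ Y ∈ D ^ (m * N), IsNilpotent ((1 - e) * Y * (1 - e)) := by
    intro Y hY
    refine isNilpotent_corner he hec hci hcie hAe hnilA hs (T := Set.range (algebraMap F k))
      (Set.infinite_range_of_injective (algebraMap F k).injective) ?_
    rintro _ ⟨a, rfl⟩
    rw [algebraMap_smul]
    exact hmin _ hmN _ (Submodule.add_mem _ hY (Submodule.smul_mem _ a hc))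
  have hcorner' : ∀ y ∈ 𝒜, IsNilpotent ((1 - e) * y * (1 - e)) := by
    intro y hy
    rw [← hD _ hmN] at hy
    exact isNilpotent_corner_span _ _ hcorner hy
  obtain ⟨L, hL⟩ := exists_pow_eq_bot_of_nil (𝒜 ⊓ LinearMap.ker (LinearMap.mulLeft k e)) (by
      rw [Submodule.mul_le]
      rintro x ⟨hx, hx'⟩ y ⟨hy, -⟩
      refine ⟨h𝒜 (Submodule.mul_mem_mul hx hy), ?_⟩
      rw [SetLike.mem_coe, LinearMap.mem_ker, LinearMap.mulLeft_apply] at hx' ⊢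
      rw [← mul_assoc, hx', zero_mul]) (by
      rintro y ⟨hy, hy'⟩
      rw [SetLike.mem_coe, LinearMap.mem_ker, LinearMap.mulLeft_apply] at hy'
      obtain ⟨t, ht⟩ := hcorner' y hy
      have hfy : (1 - e) * y = y := by rw [sub_mul, hy', one_mul, sub_zero]
      -- Since `e y = 0`, the corner of `y` acts on `y` as `y` itself, so its nilpotency passes to
      -- `y`.
      have hpow : ∀ t : ℕ, ((1 - e) * y * (1 - e)) ^ t * y = y ^ (t + 1) := by
        intro t
        induction t with
        | zero => simp
        | succ t ih =>
          have h1 : (1 - e) * y * (1 - e) * y = y * y := by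
            rw [mul_assoc ((1 - e) * y), hfy]
          rw [pow_succ, mul_assoc, h1, ← mul_assoc, ih, ← pow_succ]
      refine ⟨t + 1, ?_⟩
      rw [← hpow, ht, zero_mul])
  exact ⟨m * N, A ^ N, e, ci, L, hmN, hc, he𝒜, hec, hci, he, hL⟩

end Selection

/-! ### Peeling factors off `B ^ n` modulo the products with a factor in `D`. -/

section Filtration

variable {F A : Type*} [Field F] [Ring A] [Algebra F A]

theorem finrank_mul_le (B G : Submodule F A) [FiniteDimensional F B] [FiniteDimensional F G] :
    Module.finrank F ↥(B * G) ≤ Module.finrank F B * Module.finrank F G := by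
  rw [← Submodule.mulMap_range, ← Module.finrank_tensorProduct]
  exact LinearMap.finrank_range_le _

/-- The part of `B ^ n` generated by the products with some factor in `D`. -/
def mixedPow (B D : Submodule F A) : ℕ → Submodule F A
  | 0 => ⊥
  | n + 1 => B * mixedPow B D n ⊔ D * B ^ n

variable {B D : Submodule F A}

theorem mixedPow_le (h : D ≤ B) (n : ℕ) : mixedPow B D n ≤ B ^ n := by
  induction n with
  | zero => exact bot_le
  | succ n ih =>
    rw [pow_succ']
    exact sup_le (mul_le_mul_right ih B) (mul_le_mul_left h _)

theorem pow_mul_pow_le_mixedPow (h : D ≤ B) (m i : ℕ) :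
    D ^ (m + 1) * B ^ i ≤ mixedPow B D (m + 1 + i) := by
  rw [pow_succ', mul_assoc, add_right_comm]
  refine le_trans ?_ le_sup_right
  rw [pow_add]
  exact mul_le_mul_right (mul_le_mul_left (pow_le_pow_left' h m) _) _

theorem mul_mixedPow_le (i n : ℕ) : B ^ i * mixedPow B D n ≤ mixedPow B D (i + n) := by
  induction i with
  | zero => simp
  | succ i ih =>
    rw [pow_succ', mul_assoc, add_right_comm]
    exact (mul_le_mul_right ih B).trans le_sup_left

theorem mixedPow_mul_le (i n : ℕ) : mixedPow B D n * B ^ i ≤ mixedPow B D (n + i) := by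
  induction n with
  | zero => simp [mixedPow]
  | succ n ih =>
    rw [add_right_comm, mixedPow, mixedPow, Submodule.sup_mul, mul_assoc, mul_assoc, ← pow_add]
    exact sup_le_sup (mul_le_mul_right ih B) le_rfl

/-- This brings a codimension bound for the pair `B ^ g`, `mixedPow B D g` back to `B` and `D`. -/
theorem mixedPow_pow_le (g n : ℕ) :
    mixedPow (B ^ g) (mixedPow B D g) n ≤ mixedPow B D (g * n) := by
  induction n with
  | zero => exact bot_le
  | succ n ih =>
    rw [mixedPow, mul_add, mul_one, add_comm, ← pow_mul]
    exact sup_le ((mul_le_mul_right ih _).trans (mul_mixedPow_le g _)) (mixedPow_mul_le _ g)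

/-- If `f` maps `Y` into a space that exceeds `V` by dimension at most `q`, then the part of `Y`
mapped into `V` has codimension at most `q`. -/
theorem exists_complement_of_finrank_le {f : A →ₗ[F] A} {Y U V : Submodule F A} (hVU : V ≤ U)
    (hY : Y.map f ≤ U) [FiniteDimensional F U] [FiniteDimensional F Y] {q : ℕ}
    (hq : Module.finrank F U ≤ Module.finrank F V + q) :
    ∃ G : Submodule F A, FiniteDimensional F G ∧ Module.finrank F G ≤ q ∧
      Y ≤ (Y ⊓ V.comap f) ⊔ G := by
  obtain ⟨G, hG⟩ := Submodule.exists_isCompl ((V.comap f).comap Y.subtype)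
  refine ⟨G.map Y.subtype, inferInstance, ?_, ?_⟩
  · refine (Submodule.finrank_map_le _ _).trans ?_
    have h1 := Submodule.finrank_add_eq_of_isCompl hG
    let ψ : Y →ₗ[F] A ⧸ V := V.mkQ ∘ₗ f ∘ₗ Y.subtype
    have h2 := ψ.finrank_range_add_finrank_ker
    have h3 : LinearMap.ker ψ = (V.comap f).comap Y.subtype := by
      rw [LinearMap.ker_comp, Submodule.ker_mkQ]
      rfl
    rw [h3] at h2
    let χ : U →ₗ[F] A ⧸ V := V.mkQ ∘ₗ U.subtype
    have h4 := χ.finrank_range_add_finrank_ker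
    have h5 : LinearMap.ker χ = V.comap U.subtype := by
      rw [LinearMap.ker_comp, Submodule.ker_mkQ]
    rw [h5, (Submodule.comapSubtypeEquivOfLe hVU).finrank_eq] at h4
    have h6 : LinearMap.range ψ ≤ LinearMap.range χ := by
      rintro _ ⟨y, rfl⟩
      exact ⟨⟨f y, hY ⟨y, y.2, rfl⟩⟩, rfl⟩
    have := Submodule.finrank_mono h6
    omega
  · intro y hy
    obtain ⟨u, hu, v, hv, huv⟩ := Submodule.mem_sup.1
      (hG.sup_eq_top ▸ Submodule.mem_top : (⟨y, hy⟩ : Y) ∈ _ ⊔ G)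
    exact Submodule.mem_sup.2 ⟨u, ⟨u.2, hu⟩, v, ⟨v, hv, rfl⟩, congrArg Subtype.val huv⟩

/-- One step of the peeling of `B ^ n` modulo `mixedPow B D n`. -/
theorem exists_gluing_step (h : D ≤ B) [FiniteDimensional F B] {m n i : ℕ} (hn : n + 1 = m + 1 + i)
    {S : Submodule F A} {c e ci : A} (hc : c ∈ D ^ (m + 1)) (hec : e * c = c) (hci : ci * c = e)
    (hS : ∀ b ∈ B, (1 - e) * b ∈ S) {j f q : ℕ} {T G E : Submodule F A}
    [FiniteDimensional F G] (hG : Module.finrank F G ≤ f) (hEB : E ≤ B ^ n) (hES : E ≤ S ^ j * T)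
    (hle : B ^ n ≤ mixedPow B D n ⊔ G ⊔ E)
    (hq : Module.finrank F ((B ^ (n + 1)).map (LinearMap.mulLeft F e)) ≤
      Module.finrank F ((B ^ i).map (LinearMap.mulLeft F e)) + q) :
    ∃ G' E' : Submodule F A, FiniteDimensional F G' ∧
      Module.finrank F G' ≤ Module.finrank F B * f + q ∧ E' ≤ B ^ (n + 1) ∧ E' ≤ S ^ (j + 1) * T ∧
      B ^ (n + 1) ≤ mixedPow B D (n + 1) ⊔ G' ⊔ E' := by
  have hfin : ∀ i, FiniteDimensional F ↥(B ^ i) := fun i =>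
    Module.Finite.iff_fg.2 ((Module.Finite.iff_fg.1 inferInstance).pow i)
  have hcB : c ∈ B ^ (m + 1) := pow_le_pow_left' h _ hc
  set V := (B ^ i).map (LinearMap.mulLeft F c) with hV
  set U := (B ^ (n + 1)).map (LinearMap.mulLeft F e) with hU
  have hVB : V ≤ B ^ (n + 1) := by
    rintro _ ⟨b, hb, rfl⟩
    rw [hn, pow_add]
    exact Submodule.mul_mem_mul hcB hb
  have hVD : V ≤ mixedPow B D (n + 1) := by
    rintro _ ⟨b, hb, rfl⟩
    rw [hn]
    exact pow_mul_pow_le_mixedPow h m i (Submodule.mul_mem_mul hc hb)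
  have hVU : V ≤ U := by
    rintro _ ⟨b, hb, rfl⟩
    refine ⟨c * b, hVB ⟨b, hb, rfl⟩, ?_⟩
    rw [LinearMap.mulLeft_apply, LinearMap.mulLeft_apply, ← mul_assoc, hec]
  have hVe : (B ^ i).map (LinearMap.mulLeft F e) = V.map (LinearMap.mulLeft F ci) := by
    rw [hV, ← Submodule.map_comp]
    congr 1
    ext b
    simp [← mul_assoc, hci]
  have hYB : B * E ≤ B ^ (n + 1) := by
    rw [pow_succ']
    exact mul_le_mul_right hEB B
  have := Submodule.finiteDimensional_of_le hYB
  -- Multiplication by `ci` maps `V = c B ^ i` onto `e B ^ i`, so `V` is at least as large.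
  have hVq : Module.finrank F U ≤ Module.finrank F V + q := by
    refine hq.trans (Nat.add_le_add_right ?_ q)
    rw [hVe]
    exact Submodule.finrank_map_le _ _
  obtain ⟨H, hHfin, hHq, hYH⟩ := exists_complement_of_finrank_le hVU (Submodule.map_mono hYB) hVq
  set Z := B * E ⊓ V.comap (LinearMap.mulLeft F e) with hZ
  have hBG : FiniteDimensional F ↥(B * G) := Module.Finite.iff_fg.2
    ((Module.Finite.iff_fg.1 inferInstance).mul (Module.Finite.iff_fg.1 inferInstance))
  refine ⟨B * G ⊔ H, Z.map (LinearMap.mulLeft F (1 - e)), inferInstance, ?_, ?_, ?_, ?_⟩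
  · refine (Submodule.finrank_add_le_finrank_add_finrank _ _).trans (Nat.add_le_add ?_ hHq)
    exact (finrank_mul_le B G).trans (Nat.mul_le_mul_left _ hG)
  · rintro _ ⟨z, ⟨hz, hz'⟩, rfl⟩
    rw [LinearMap.mulLeft_apply, sub_mul, one_mul]
    exact Submodule.sub_mem _ (hYB hz) (hVB hz')
  · have h1 : (B * E).map (LinearMap.mulLeft F (1 - e)) ≤ S * (S ^ j * T) := by
      rw [Submodule.map_le_iff_le_comap, Submodule.mul_le]
      intro b hb x hx
      rw [Submodule.mem_comap, LinearMap.mulLeft_apply, ← mul_assoc (1 - e)]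
      exact Submodule.mul_mem_mul (hS b hb) (hES hx)
    rw [pow_succ', mul_assoc]
    exact (Submodule.map_mono inf_le_left).trans h1
  -- For `z ∈ Z` the part `e z` lies in `V`, which consists of products with factors in `D`; only
  -- `(1 - e) z` survives.
  · have h1 : Z ≤ mixedPow B D (n + 1) ⊔ Z.map (LinearMap.mulLeft F (1 - e)) := by
      intro z hz
      refine Submodule.mem_sup.2 ⟨e * z, hVD hz.2, (1 - e) * z, ⟨z, hz, rfl⟩, ?_⟩
      rw [sub_mul, one_mul, add_sub_cancel]
    have h2 : B * mixedPow B D n ≤ mixedPow B D (n + 1) := le_sup_left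
    calc B ^ (n + 1) = B * B ^ n := pow_succ' B n
      _ ≤ B * (mixedPow B D n ⊔ G ⊔ E) := mul_le_mul_right hle B
      _ = B * mixedPow B D n ⊔ B * G ⊔ B * E := by rw [Submodule.mul_sup, Submodule.mul_sup]
      _ ≤ mixedPow B D (n + 1) ⊔ B * G ⊔
          (mixedPow B D (n + 1) ⊔ Z.map (LinearMap.mulLeft F (1 - e)) ⊔ H) :=
        sup_le_sup (sup_le_sup h2 le_rfl) (hYH.trans (sup_le_sup h1 le_rfl))
      _ ≤ _ := by
        refine sup_le (sup_le ?_ ?_) (sup_le (sup_le ?_ ?_) ?_)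
        · exact le_sup_of_le_left le_sup_left
        · exact le_sup_of_le_left (le_sup_of_le_right le_sup_left)
        · exact le_sup_of_le_left le_sup_left
        · exact le_sup_right
        · exact le_sup_of_le_left (le_sup_of_le_right le_sup_right)

theorem exists_gluing (h : D ≤ B) [FiniteDimensional F B] {m N : ℕ}
    {S : Submodule F A} {c e ci : A} (hc : c ∈ D ^ (m + 1)) (hec : e * c = c) (hci : ci * c = e)
    (hS : ∀ b ∈ B, (1 - e) * b ∈ S) {q L : ℕ}
    (hq : ∀ i < L, Module.finrank F ((B ^ (N + i + (m + 1))).map (LinearMap.mulLeft F e)) ≤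
      Module.finrank F ((B ^ (N + i)).map (LinearMap.mulLeft F e)) + q) :
    ∃ G E : Submodule F A, FiniteDimensional F G ∧
      Module.finrank F G ≤ (fun f => Module.finrank F B * f + q)^[L] 0 ∧ E ≤ B ^ (N + m + L) ∧
      E ≤ S ^ L * ⊤ ∧ B ^ (N + m + L) ≤ mixedPow B D (N + m + L) ⊔ G ⊔ E := by
  induction L with
  | zero =>
    refine ⟨⊥, B ^ (N + m), inferInstance, by simp, le_rfl, ?_, le_sup_right⟩
    intro x _
    rw [pow_zero, ← one_mul x]
    exact Submodule.mul_mem_mul (Submodule.one_le.1 le_rfl) Submodule.mem_top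
  | succ L ih =>
    obtain ⟨G, E, hGfin, hG, hEB, hES, hle⟩ := ih fun i hi => hq i (hi.trans (Nat.lt_succ_self L))
    rw [Function.iterate_succ_apply', ← add_assoc]
    refine exists_gluing_step h (m := m) (i := N + L) (by omega) hc hec hci hS hG hEB hES hle ?_
    have := hq L (Nat.lt_succ_self L)
    rwa [show N + L + (m + 1) = N + m + L + 1 by omega] at this

end Filtration

/-- Otherwise the sum of `a` over a window of length `L` gains more than `L C m` at each step of
length `m`, by monotonicity of the other terms. This contradicts its linear bound of slope `L C`. -/
theorem exists_small_increments {a : ℕ → ℕ} {C m : ℕ} (ha : ∀ n, a n ≤ C * (n + 1))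
    (hmono : ∀ n, a n ≤ a (n + m)) (L N : ℕ) :
    ∃ n, N ≤ n ∧ ∀ i < L, a (n + i + m) ≤ a (n + i) + L * C * m := by
  by_contra hcon
  push Not at hcon
  let s : ℕ → ℕ := fun n => ∑ i ∈ Finset.range L, a (n + i)
  have hstep : ∀ n, N ≤ n → s n + (L * C * m + 1) ≤ s (n + m) := by
    intro n hn
    obtain ⟨i, hi, hlt⟩ := hcon n hn
    have hi' := Finset.mem_range.2 hi
    have h1 : ∑ i' ∈ (Finset.range L).erase i, a (n + i') ≤
        ∑ i' ∈ (Finset.range L).erase i, a (n + m + i') := by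
      refine Finset.sum_le_sum fun i' _ => ?_
      rw [add_right_comm]
      exact hmono _
    have h2 := Finset.add_sum_erase (Finset.range L) (fun i => a (n + i)) hi'
    have h3 := Finset.add_sum_erase (Finset.range L) (fun i => a (n + m + i)) hi'
    rw [add_right_comm] at hlt
    simp only [s]
    omega
  have hlow : ∀ t, t * (L * C * m + 1) ≤ s (N + t * m) := by
    intro t
    induction t with
    | zero => simp
    | succ t ih =>
      have := hstep (N + t * m) (Nat.le_add_right _ _)
      rw [Nat.succ_mul, Nat.succ_mul, ← add_assoc N]
      omega
  have hup : ∀ n, s n ≤ L * (C * (n + L)) := by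
    intro n
    refine (Finset.sum_le_card_nsmul _ _ (C * (n + L)) fun i hi => ?_).trans (by simp)
    refine (ha _).trans (Nat.mul_le_mul_left C ?_)
    have := Finset.mem_range.1 hi
    omega
  have h1 := (hlow (L * C * (N + L) + 1)).trans (hup _)
  nlinarith

section Matrix

variable {F k : Type*} [Field F] [Infinite F] [Field k] [Algebra F k]
  {n : Type*} [Fintype n] [DecidableEq n]

/-- If all powers of `D ≤ B` have the same span over the big field as `B`, and the dimensions of the
powers of `B` grow linearly, then the codimension of `mixedPow B D N` in `B ^ N` is bounded for
infinitely many `N`. -/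
theorem exists_bounded_codim (B D : Submodule F (Matrix n n k)) [FiniteDimensional F B]
    (h : D ≤ B) (𝒜 : Submodule k (Matrix n n k))
    (hD : ∀ m : ℕ, 1 ≤ m → Submodule.span k ((D ^ m : Submodule F (Matrix n n k)) :
      Set (Matrix n n k)) = 𝒜) (h𝒜 : 𝒜 * 𝒜 ≤ 𝒜) (hB𝒜 : ∀ b ∈ B, b ∈ 𝒜) (C : ℕ)
    (hgrowth : ∀ N, Module.finrank F ↥(B ^ N) ≤ C * (N + 1)) :
    ∃ r : ℕ, ∀ N₀ : ℕ, ∃ N, N₀ ≤ N ∧ ∃ G : Submodule F (Matrix n n k), FiniteDimensional F G ∧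
      Module.finrank F G ≤ r ∧ B ^ N ≤ mixedPow B D N ⊔ G := by
  obtain ⟨m, c, e, ci, L, hm, hc, he𝒜, hec, hci, he, hL⟩ := exists_fitting_identity D 𝒜 hD h𝒜
  obtain ⟨m, rfl⟩ : ∃ m', m = m' + 1 := ⟨m - 1, by omega⟩
  set S := 𝒜 ⊓ LinearMap.ker (LinearMap.mulLeft k e)
  have hfin : ∀ i, FiniteDimensional F ↥(B ^ i) := fun i =>
    Module.Finite.iff_fg.2 ((Module.Finite.iff_fg.1 inferInstance).pow i)
  have hS : ∀ b ∈ B, (1 - e) * b ∈ S.restrictScalars F := by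
    intro b hb
    rw [Submodule.restrictScalars_mem]
    refine ⟨?_, ?_⟩
    · rw [sub_mul, one_mul]
      exact Submodule.sub_mem _ (hB𝒜 b hb) (h𝒜 (Submodule.mul_mem_mul he𝒜 (hB𝒜 b hb)))
    · rw [SetLike.mem_coe, LinearMap.mem_ker, LinearMap.mulLeft_apply, ← mul_assoc, mul_sub, he]
      simp
  have hSpow : ∀ L, S.restrictScalars F ^ L ≤ (S ^ L).restrictScalars F := by
    intro L
    induction L with
    | zero =>
      have h1 : (1 : Matrix n n k) ∈ (1 : Submodule k (Matrix n n k)) := Submodule.one_le.1 le_rfl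
      rw [pow_zero, pow_zero, Submodule.one_le]
      exact h1
    | succ L ih =>
      rw [pow_succ, Submodule.mul_le]
      intro x hx y hy
      have h1 : x * y ∈ S ^ L * S := Submodule.mul_mem_mul (ih hx) hy
      rw [← pow_succ] at h1
      exact h1
  have hbot : S.restrictScalars F ^ L = ⊥ := by
    rw [eq_bot_iff]
    refine (hSpow L).trans ?_
    rw [hL]
    exact le_rfl
  have hmono : ∀ i, Module.finrank F ((B ^ i).map (LinearMap.mulLeft F e)) ≤
      Module.finrank F ((B ^ (i + (m + 1))).map (LinearMap.mulLeft F e)) := by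
    intro i
    have h1 : (B ^ i).map (LinearMap.mulLeft F e) ≤
        ((B ^ (i + (m + 1))).map (LinearMap.mulLeft F e)).map (LinearMap.mulLeft F ci) := by
      rintro _ ⟨b, hb, rfl⟩
      refine ⟨c * b, ⟨c * b, ?_, ?_⟩, ?_⟩
      · rw [add_comm, pow_add]
        exact Submodule.mul_mem_mul (pow_le_pow_left' h _ hc) hb
      · rw [LinearMap.mulLeft_apply, ← mul_assoc, hec]
      · rw [LinearMap.mulLeft_apply, LinearMap.mulLeft_apply, ← mul_assoc, hci]
    exact (Submodule.finrank_mono h1).trans (Submodule.finrank_map_le _ _)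
  refine ⟨(fun f => Module.finrank F B * f + L * C * (m + 1))^[L] 0, fun N₀ => ?_⟩
  obtain ⟨N, hN, hq⟩ := exists_small_increments
    (a := fun i => Module.finrank F ((B ^ i).map (LinearMap.mulLeft F e))) (C := C) (m := m + 1)
    (fun i => (Submodule.finrank_map_le _ _).trans (hgrowth i)) hmono L N₀
  obtain ⟨G, E, hGfin, hG, -, hES, hle⟩ := exists_gluing h hc hec hci hS hq
  refine ⟨N + m + L, by omega, G, hGfin, hG, ?_⟩
  rw [hbot, Submodule.bot_mul, le_bot_iff] at hES
  rwa [hES, sup_bot_eq] at hle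

end Matrix

/-! ### Idempotent powers, and spans over a larger field. -/

open scoped Pointwise

theorem exists_pow_two_mul_eq {T : Type*} [Monoid T] [Finite T] (a : T) :
    ∃ h : ℕ, 1 ≤ h ∧ a ^ (h * 2) = a ^ h := by
  obtain ⟨i, t, ht, hit⟩ : ∃ i t : ℕ, 1 ≤ t ∧ a ^ (i + t) = a ^ i := by
    obtain ⟨i, j, hij, h⟩ := Finite.exists_ne_map_eq_of_infinite (fun i : ℕ => a ^ i)
    rcases lt_or_gt_of_ne hij with hlt | hlt
    · exact ⟨i, j - i, by omega, by rw [Nat.add_sub_cancel' hlt.le]; exact h.symm⟩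
    · exact ⟨j, i - j, by omega, by rw [Nat.add_sub_cancel' hlt.le]; exact h⟩
  have hper : ∀ c, a ^ (i + t * c) = a ^ i := by
    intro c
    induction c with
    | zero => simp
    | succ c ih => rw [mul_add, mul_one, ← add_assoc, add_right_comm, pow_add, hit, ← pow_add, ih]
  refine ⟨t * (i + 1), Nat.mul_pos ht (Nat.succ_pos i), ?_⟩
  have hle : i ≤ t * (i + 1) := by nlinarith
  obtain ⟨u, hu⟩ := Nat.exists_eq_add_of_le hle
  have : t * (i + 1) * 2 = (i + t * (i + 1)) + u := by omega
  rw [this, pow_add, hper, ← pow_add, ← hu]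

section Tower

variable {F k A : Type*} [Field F] [Field k] [Algebra F k] [Ring A] [Algebra F A] [Algebra k A]
  [IsScalarTower F k A]

theorem span_coe_mul (M N : Submodule F A) :
    Submodule.span k ((M * N : Submodule F A) : Set A) =
      Submodule.span k (M : Set A) * Submodule.span k (N : Set A) := by
  rw [Submodule.mul_eq_span_mul_set, Submodule.span_span_of_tower, Submodule.span_mul_span]

theorem span_coe_pow (M : Submodule F A) (n : ℕ) :
    Submodule.span k ((M ^ n : Submodule F A) : Set A) = Submodule.span k (M : Set A) ^ n := by
  rw [Submodule.pow_eq_span_pow_set, Submodule.span_span_of_tower, Submodule.span_pow]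

/-- When a product of factors from `D + W` is expanded, only the term in `W ^ n` has no factor in
`D`. -/
theorem span_pow_le_span_mixedPow {B D : Submodule F A} {W : Submodule k A}
    (hBW : Submodule.span k (B : Set A) ≤ Submodule.span k (D : Set A) ⊔ W)
    (hWB : W ≤ Submodule.span k (B : Set A)) (n : ℕ) :
    Submodule.span k (B : Set A) ^ n ≤
      Submodule.span k (mixedPow B D n : Set A) ⊔ W ^ n := by
  induction n with
  | zero => simp
  | succ n ih =>
    rw [mixedPow]
    have h1 : Submodule.span k ((B * mixedPow B D n : Submodule F A) : Set A) ≤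
        Submodule.span k ((B * mixedPow B D n ⊔ D * B ^ n : Submodule F A) : Set A) :=
      Submodule.span_mono (SetLike.coe_subset_coe.2 le_sup_left)
    have h2 : Submodule.span k ((D * B ^ n : Submodule F A) : Set A) ≤
        Submodule.span k ((B * mixedPow B D n ⊔ D * B ^ n : Submodule F A) : Set A) :=
      Submodule.span_mono (SetLike.coe_subset_coe.2 le_sup_right)
    rw [span_coe_mul] at h1 h2
    rw [span_coe_pow] at h2
    calc _ = Submodule.span k (B : Set A) * Submodule.span k (B : Set A) ^ n := pow_succ' _ _
      _ ≤ (Submodule.span k (D : Set A) ⊔ W) * Submodule.span k (B : Set A) ^ n :=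
        mul_le_mul_left hBW _
      _ = Submodule.span k (D : Set A) * Submodule.span k (B : Set A) ^ n ⊔
          W * Submodule.span k (B : Set A) ^ n := Submodule.sup_mul _ _ _
      _ ≤ Submodule.span k (D : Set A) * Submodule.span k (B : Set A) ^ n ⊔
          (W * Submodule.span k (mixedPow B D n : Set A) ⊔ W * W ^ n) := by
        refine sup_le_sup le_rfl ?_
        rw [← Submodule.mul_sup]
        exact mul_le_mul_right ih W
      _ ≤ _ := by
        refine sup_le (le_sup_of_le_left h2) (sup_le (le_sup_of_le_left ?_) ?_)
        · exact (mul_le_mul_left hWB _).trans h1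
        · rw [pow_succ']
          exact le_sup_right

theorem span_mixedPow_eq {B D : Submodule F A} (h : D ≤ B) {W : Submodule k A}
    (hBW : Submodule.span k (B : Set A) ≤ Submodule.span k (D : Set A) ⊔ W)
    (hWB : W ≤ Submodule.span k (B : Set A)) {α n : ℕ} (hW : W ^ α = ⊥) (hn : α ≤ n) :
    Submodule.span k (mixedPow B D n : Set A) = Submodule.span k (B : Set A) ^ n := by
  refine le_antisymm ?_ ?_
  · rw [← span_coe_pow]
    exact Submodule.span_mono (mixedPow_le h n)
  · refine (span_pow_le_span_mixedPow hBW hWB n).trans (sup_le le_rfl ?_)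
    rw [← Nat.sub_add_cancel hn, pow_add, hW, Submodule.mul_bot]
    exact bot_le

end Tower

/-- A subspace that contains infinitely many values of a polynomial with vector coefficients
contains the coefficients. -/
theorem coeff_mem_of_infinite {k V : Type*} [Field k] [AddCommGroup V] [Module k V]
    (U : Submodule k V) (N : ℕ) (c : ℕ → V) (T : Set k) (hT : T.Infinite)
    (h : ∀ z ∈ T, ∑ i ∈ Finset.range N, z ^ i • c i ∈ U) {i : ℕ} (hi : i < N) : c i ∈ U := by
  by_contra hc
  obtain ⟨f, hf, hfU⟩ := Submodule.exists_le_ker_of_notMem hc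
  let P : k[X] := ∑ i ∈ Finset.range N, monomial i (f (c i))
  have hP : P = 0 := by
    refine eq_zero_of_infinite_isRoot P (hT.mono fun z hz => ?_)
    have := hfU (h z hz)
    rw [LinearMap.mem_ker, map_sum] at this
    rw [Set.mem_ofPred_eq, IsRoot, eval_finsetSum, ← this]
    refine Finset.sum_congr rfl fun i _ => ?_
    rw [eval_monomial, map_smul, smul_eq_mul, mul_comm]
  apply hf
  have := congrArg (fun P => coeff P i) hP
  simpa [P, finsetSum_coeff, coeff_monomial, hi] using this

theorem infinite_range_X_add {F k : Type*} [Field F] [Infinite F] [Field k] [Algebra F[X] k]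
    [Algebra F k] :
    (Set.range fun s : F => algebraMap F[X] k X + algebraMap F k s).Infinite :=
  Set.infinite_range_of_injective fun _ _ h => (algebraMap F k).injective (add_left_cancel h)

/-! ### Spans of shifted matrices of polynomials. -/

section Shifts

variable {F : Type*} [Field F] {n : Type*} {ι : Type*}

/-- Matrices of polynomials of degree at most `m`. -/
def degreeLEMat (F : Type*) [Field F] (n : Type*) (m : ℕ) : Submodule F (Matrix n n F[X]) where
  carrier := {A | ∀ i j, (A i j).natDegree ≤ m}
  zero_mem' := fun i j => by simp
  add_mem' := fun {A B} hA hB i j => (natDegree_add_le _ _).trans (max_le (hA i j) (hB i j))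
  smul_mem' := fun c A hA i j => (natDegree_smul_le _ _).trans (hA i j)

/-- The coefficients of a matrix of polynomials of degree at most `m`. -/
noncomputable def coeffMat (F : Type*) [Field F] (n : Type*) (m : ℕ) :
    degreeLEMat F n m →ₗ[F] (n × n × Fin (m + 1) → F) where
  toFun A q := (A.1 q.1 q.2.1).coeff q.2.2
  map_add' A B := by ext; simp
  map_smul' c A := by ext; simp

theorem coeffMat_injective (m : ℕ) : Function.Injective (coeffMat F n m) := by
  intro A B h
  ext i j l
  by_cases hl : l < m + 1
  · exact congrFun h (i, j, ⟨l, hl⟩)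
  · rw [coeff_eq_zero_of_natDegree_lt ((A.2 i j).trans_lt (by omega)),
      coeff_eq_zero_of_natDegree_lt ((B.2 i j).trans_lt (by omega))]

instance [Finite n] (m : ℕ) : FiniteDimensional F (degreeLEMat F n m) :=
  FiniteDimensional.of_injective _ (coeffMat_injective m)

theorem finrank_degreeLEMat_le [Fintype n] (m : ℕ) :
    Module.finrank F (degreeLEMat F n m) ≤ Fintype.card n * (Fintype.card n * (m + 1)) := by
  refine (LinearMap.finrank_le_finrank_of_injective (coeffMat_injective m)).trans ?_
  simp [Module.finrank_fintype_fun_eq_card]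

variable [Fintype n] [DecidableEq n]

/-- The substitution `X ↦ X + s` on matrices of polynomials. -/
noncomputable def shiftMat (s : F) : Matrix n n F[X] →ₐ[F] Matrix n n F[X] :=
  (aeval (X + C s)).mapMatrix

/-- The `F`-span of all shifts of the matrices `p v`. -/
noncomputable def shiftSpan (p : ι → Matrix n n F[X]) : Submodule F (Matrix n n F[X]) :=
  Submodule.span F (Set.range fun q : F × ι => shiftMat q.1 (p q.2))

/-- The `F`-span of all differences of two shifts of one of the matrices `p v`. -/
noncomputable def shiftDiffSpan (p : ι → Matrix n n F[X]) : Submodule F (Matrix n n F[X]) :=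
  Submodule.span F
    (Set.range fun q : F × F × ι => shiftMat q.1 (p q.2.2) - shiftMat q.2.1 (p q.2.2))

theorem shiftDiffSpan_le (p : ι → Matrix n n F[X]) : shiftDiffSpan p ≤ shiftSpan p := by
  rw [shiftDiffSpan, Submodule.span_le]
  rintro _ ⟨⟨s, t, v⟩, rfl⟩
  exact Submodule.sub_mem _ (Submodule.subset_span ⟨(s, v), rfl⟩)
    (Submodule.subset_span ⟨(t, v), rfl⟩)

theorem degreeLEMat_mul_le (a b : ℕ) :
    degreeLEMat F n a * degreeLEMat F n b ≤ degreeLEMat F n (a + b) := by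
  rw [Submodule.mul_le]
  intro A hA B hB i j
  rw [Matrix.mul_apply]
  exact natDegree_sum_le_of_forall_le _ _ fun l _ =>
    natDegree_mul_le.trans (Nat.add_le_add (hA i l) (hB l j))

theorem pow_le_degreeLEMat {B : Submodule F (Matrix n n F[X])} {m : ℕ}
    (hB : B ≤ degreeLEMat F n m) (N : ℕ) : B ^ N ≤ degreeLEMat F n (m * N) := by
  induction N with
  | zero =>
    rw [pow_zero, Submodule.one_le]
    intro i j
    by_cases h : i = j <;> simp [Matrix.one_apply, h]
  | succ N ih =>
    rw [pow_succ]
    exact (mul_le_mul' ih hB).trans (degreeLEMat_mul_le _ _)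

theorem exists_shiftSpan_le_degreeLEMat [Finite ι] (p : ι → Matrix n n F[X]) :
    ∃ m, (∀ v, p v ∈ degreeLEMat F n m) ∧ shiftSpan p ≤ degreeLEMat F n m := by
  have := Fintype.ofFinite ι
  let m := Finset.univ.sup fun q : ι × n × n => (p q.1 q.2.1 q.2.2).natDegree
  have hm : ∀ v, p v ∈ degreeLEMat F n m := fun v i j =>
    Finset.le_sup (f := fun q : ι × n × n => (p q.1 q.2.1 q.2.2).natDegree)
      (Finset.mem_univ (v, i, j))
  refine ⟨m, hm, ?_⟩
  rw [shiftSpan, Submodule.span_le]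
  rintro _ ⟨⟨s, v⟩, rfl⟩ i j
  have : (shiftMat s (p v)) i j = (p v i j).comp (X + C s) := rfl
  dsimp only
  rw [this]
  exact natDegree_comp_le.trans (by simpa using hm v i j)

section Fraction

variable {k : Type*} [Field k] [Algebra F[X] k] [Algebra F k] [IsScalarTower F F[X] k]

variable (F n k) in
/-- Matrices of polynomials as matrices over a field containing the polynomials. -/
noncomputable def toFieldMat : Matrix n n F[X] →ₐ[F] Matrix n n k :=
  (IsScalarTower.toAlgHom F F[X] k).mapMatrix

variable (F n k) in
theorem toFieldMat_injective [FaithfulSMul F[X] k] : Function.Injective (toFieldMat F n k) := by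
  intro A B h
  ext1 i j
  exact FaithfulSMul.algebraMap_injective F[X] k (congrFun (congrFun h i) j)

variable (k) in
/-- The matrix of the coefficients of `X ^ i`. -/
def coeffFieldMat (A : Matrix n n F[X]) (i : ℕ) : Matrix n n k :=
  A.map fun f => algebraMap F k (f.coeff i)

theorem toFieldMat_shiftMat {m : ℕ} {A : Matrix n n F[X]} (hA : A ∈ degreeLEMat F n m) (s : F) :
    toFieldMat F n k (shiftMat s A) = ∑ i ∈ Finset.range (m + 1),
      (algebraMap F[X] k X + algebraMap F k s) ^ i • coeffFieldMat k A i := by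
  ext a b
  have h1 : toFieldMat F n k (shiftMat s A) a b =
      algebraMap F[X] k (aeval (X + C s) (A a b)) := rfl
  rw [h1, ← aeval_algebraMap_apply, aeval_eq_sum_range' (Nat.lt_succ_of_le (hA a b)),
    Matrix.sum_apply]
  refine Finset.sum_congr rfl fun i _ => ?_
  rw [map_add, ← algebraMap_eq, ← IsScalarTower.algebraMap_apply, Matrix.smul_apply, smul_eq_mul,
    mul_comm, Algebra.smul_def]
  rfl

variable (k) in
/-- The span over the big field of all coefficient matrices. -/
noncomputable def coeffSpan (p : ι → Matrix n n F[X]) (m : ℕ) : Submodule k (Matrix n n k) :=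
  Submodule.span k (Set.range fun q : ι × Fin (m + 1) => coeffFieldMat k (p q.1) q.2)

variable [Infinite F] {p : ι → Matrix n n F[X]} {m : ℕ}

/-- A shift is the value at `X + s` of a polynomial with the coefficient matrices as coefficients.
Infinitely many of its values determine the coefficients by `coeff_mem_of_infinite`. -/
theorem span_map_shiftSpan (hp : ∀ v, p v ∈ degreeLEMat F n m) : Submodule.span k
    (((shiftSpan p).map (toFieldMat F n k).toLinearMap : Submodule F (Matrix n n k)) :
      Set (Matrix n n k)) = coeffSpan k p m := by
  refine le_antisymm ?_ ?_
  · have h : (shiftSpan p).map (toFieldMat F n k).toLinearMap ≤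
        (coeffSpan k p m).restrictScalars F := by
      rw [shiftSpan, Submodule.map_span, Submodule.span_le]
      rintro _ ⟨_, ⟨⟨s, v⟩, rfl⟩, rfl⟩
      rw [AlgHom.toLinearMap_apply, toFieldMat_shiftMat (hp v)]
      exact Submodule.sum_mem _ fun i hi => Submodule.smul_mem (coeffSpan k p m) _
        (Submodule.subset_span ⟨(v, ⟨i, Finset.mem_range.1 hi⟩), rfl⟩)
    exact Submodule.span_le.2 h
  · rw [coeffSpan, Submodule.span_le]
    rintro _ ⟨⟨v, i⟩, rfl⟩
    refine coeff_mem_of_infinite _ (m + 1) (coeffFieldMat k (p v)) _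
      (infinite_range_X_add (F := F)) ?_ i.2
    rintro _ ⟨s, rfl⟩
    rw [← toFieldMat_shiftMat (hp v)]
    exact Submodule.subset_span ⟨_, Submodule.subset_span ⟨(s, v), rfl⟩, rfl⟩

theorem coeffSpan_le_sup (hp : ∀ v, p v ∈ degreeLEMat F n m) : coeffSpan k p m ≤ Submodule.span k
    (((shiftDiffSpan p).map (toFieldMat F n k).toLinearMap : Submodule F (Matrix n n k)) :
      Set (Matrix n n k)) ⊔ Submodule.span k (Set.range fun v => coeffFieldMat k (p v) 0) := by
  rw [coeffSpan, Submodule.span_le]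
  rintro _ ⟨⟨v, i, hi⟩, rfl⟩
  rcases i with _ | i
  · exact Submodule.mem_sup_right (Submodule.subset_span ⟨v, rfl⟩)
  refine Submodule.mem_sup_left ?_
  -- Subtracting the unshifted matrix from the constant coefficient makes the values at `X + s`
  -- differences of shifts, and leaves the higher coefficients unchanged.
  set c : ℕ → Matrix n n k := fun i => coeffFieldMat k (p v) i -
    if i = 0 then toFieldMat F n k (shiftMat 0 (p v)) else 0 with hc
  have hmem := coeff_mem_of_infinite (Submodule.span k
    (((shiftDiffSpan p).map (toFieldMat F n k).toLinearMap : Submodule F (Matrix n n k)) :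
      Set (Matrix n n k))) (m + 1) c _ (infinite_range_X_add (F := F)) (by
    rintro _ ⟨s, rfl⟩
    have : ∑ i ∈ Finset.range (m + 1), (algebraMap F[X] k X + algebraMap F k s) ^ i • c i =
        toFieldMat F n k (shiftMat s (p v) - shiftMat 0 (p v)) := by
      simp only [hc, smul_sub, Finset.sum_sub_distrib, map_sub]
      rw [← toFieldMat_shiftMat (hp v)]
      simp
    rw [this]
    exact Submodule.subset_span ⟨_, Submodule.subset_span ⟨(s, 0, v), rfl⟩, rfl⟩) hi
  simpa [hc] using hmem

end Fraction

end Shifts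

theorem map_mixedPow {F A A' : Type*} [Field F] [Ring A] [Algebra F A] [Ring A'] [Algebra F A']
    (φ : A →ₐ[F] A') (B D : Submodule F A) (n : ℕ) :
    (mixedPow B D n).map φ.toLinearMap =
      mixedPow (B.map φ.toLinearMap) (D.map φ.toLinearMap) n := by
  induction n with
  | zero => simp [mixedPow]
  | succ n ih =>
    rw [mixedPow, mixedPow, Submodule.map_sup, Submodule.map_mul, Submodule.map_mul,
      Submodule.map_pow, ih]

/-! ### Bounded codimension for families of matrices of polynomials. -/

section

variable {F : Type*} [Field F] {n : Type*} [Fintype n] [DecidableEq n] {ι : Type*}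

/-- The finitely many coefficients are algebraic over `K` and generate a finite ring, so the set of
coefficient matrices lives in a finite monoid of sets of matrices, where some power is idempotent.
-/
theorem exists_coeffSpan_pow_eq [Finite ι] (K : Type*) [Field K] [Finite K] [Algebra K F]
    [Algebra.IsAlgebraic K F] {k : Type*} [Field k] [Algebra F k] (p : ι → Matrix n n F[X])
    (m : ℕ) : ∃ h : ℕ, 1 ≤ h ∧ coeffSpan k p m ^ (h * 2) = coeffSpan k p m ^ h := by
  let T : Set F := Set.range fun q : ι × n × n × Fin (m + 1) =>
    (p q.1 q.2.1 q.2.2.1).coeff q.2.2.2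
  have hfg : (Algebra.adjoin K T).toSubmodule.FG :=
    fg_adjoin_of_finite (Set.finite_range _) fun x _ => Algebra.IsIntegral.isIntegral x
  have hfin : Module.Finite K (Algebra.adjoin K T) := Module.Finite.iff_fg.2 hfg
  have hE : Finite (Algebra.adjoin K T) := Module.finite_of_finite K
  let f : Matrix n n (Algebra.adjoin K T) →+* Matrix n n k :=
    ((algebraMap F k).comp (Algebra.adjoin K T).subtype).mapMatrix
  let S : Set (Matrix n n (Algebra.adjoin K T)) := Set.range fun q : ι × Fin (m + 1) =>
    Matrix.of fun a b => ⟨(p q.1 a b).coeff q.2, Algebra.subset_adjoin ⟨(q.1, a, b, q.2), rfl⟩⟩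
  have hS : coeffSpan k p m = Submodule.span k (f '' S) := by
    rw [coeffSpan, ← Set.range_comp]
    rfl
  obtain ⟨h, h1, hh⟩ := exists_pow_two_mul_eq S
  refine ⟨h, h1, ?_⟩
  rw [hS, Submodule.span_pow, Submodule.span_pow, ← Set.image_pow, ← Set.image_pow, hh]

theorem span_coeffFieldMat_pow_eq_bot {k : Type*} [Field k] [Algebra F k]
    (p : ι → Matrix n n F[X]) {α : ℕ}
    (hα : Submodule.span F (Set.range fun v => (p v).map (eval 0)) ^ α = ⊥) :
    Submodule.span k (Set.range fun v => coeffFieldMat k (p v) 0) ^ α = ⊥ := by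
  let f : Matrix n n F →ₐ[F] Matrix n n k := (Algebra.ofId F k).mapMatrix
  have h : (Set.range fun v => coeffFieldMat k (p v) 0) =
      f.toLinearMap '' (Set.range fun v => (p v).map (eval 0)) := by
    rw [← Set.range_comp]
    congr 1
    ext v a b
    change algebraMap F k ((p v a b).coeff 0) = algebraMap F k ((p v a b).eval 0)
    rw [coeff_zero_eq_eval_zero]
  rw [h, ← Submodule.span_span_of_tower F, ← Submodule.map_span, ← span_coe_pow,
    ← Submodule.map_pow, hα]
  simp

/-- For matrices of polynomials over an infinite algebraic extension of a finite field with
nilpotent values at `0`, the codimension of `mixedPow` is bounded for infinitely many exponents. -/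
theorem exists_bounded_codim_shiftSpan [Finite ι] [Infinite F] (K : Type*) [Field K] [Finite K] [Algebra K F]
    [Algebra.IsAlgebraic K F] (p : ι → Matrix n n F[X]) {α : ℕ}
    (hα : Submodule.span F (Set.range fun v => (p v).map (eval 0)) ^ α = ⊥) :
    ∃ r : ℕ, ∀ N₀ : ℕ, ∃ N, N₀ ≤ N ∧ Module.finrank F ↥(shiftSpan p ^ N) ≤
      Module.finrank F (mixedPow (shiftSpan p) (shiftDiffSpan p) N) + r := by
  obtain ⟨m, hpm, hm⟩ := exists_shiftSpan_le_degreeLEMat p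
  let φ := toFieldMat F n (FractionRing F[X])
  have hφ : Function.Injective φ.toLinearMap := toFieldMat_injective F n (FractionRing F[X])
  set 𝒲 := coeffSpan (FractionRing F[X]) p m
  obtain ⟨h, h1, hh⟩ := exists_coeffSpan_pow_eq K (k := FractionRing F[X]) p m
  -- A multiple of `h`, so that `𝒲 ^ g` is idempotent, and at least `α`, so that the constant
  -- coefficients contribute nothing to it.
  set g := h * (α + 1) with hg
  have hg1 : 1 ≤ g := Nat.mul_pos h1 (Nat.succ_pos α)
  have hgα : α ≤ g := by nlinarith
  set B := (shiftSpan p).map φ.toLinearMap with hB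
  set D := (shiftDiffSpan p).map φ.toLinearMap with hD
  have hDB : D ≤ B := Submodule.map_mono (shiftDiffSpan_le p)
  have hspanB : Submodule.span (FractionRing F[X]) (B : Set (Matrix n n (FractionRing F[X]))) = 𝒲 :=
    span_map_shiftSpan hpm
  have hfinpow : ∀ N, FiniteDimensional F ↥(shiftSpan p ^ N) := fun N =>
    Submodule.finiteDimensional_of_le (pow_le_degreeLEMat hm N)
  have hBpow : ∀ N, B ^ N = (shiftSpan p ^ N).map φ.toLinearMap := fun N => by
    rw [hB, ← Submodule.map_pow]
  have hfinB : ∀ N, FiniteDimensional F ↥(B ^ N) := fun N => by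
    rw [hBpow]
    infer_instance
  have hidem : 𝒲 ^ g * 𝒲 ^ g = 𝒲 ^ g := by
    rw [← pow_add, ← mul_two, hg, mul_right_comm, pow_mul, hh, ← pow_mul]
  have hspanD : Submodule.span (FractionRing F[X])
      (mixedPow B D g : Set (Matrix n n (FractionRing F[X]))) = 𝒲 ^ g := by
    rw [← hspanB]
    refine span_mixedPow_eq hDB (W := Submodule.span (FractionRing F[X])
      (Set.range fun v => coeffFieldMat (FractionRing F[X]) (p v) 0)) ?_ ?_
      (span_coeffFieldMat_pow_eq_bot p hα) hgα
    · rw [hspanB]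
      exact coeffSpan_le_sup hpm
    · rw [hspanB]
      exact Submodule.span_mono (by rintro _ ⟨v, rfl⟩; exact ⟨(v, 0), rfl⟩)
  obtain ⟨r, hr⟩ := exists_bounded_codim (B ^ g) (mixedPow B D g) (mixedPow_le hDB g) (𝒲 ^ g)
    (fun i hi => by
      rw [span_coe_pow, hspanD]
      obtain ⟨i, rfl⟩ : ∃ i', i = i' + 1 := ⟨i - 1, by omega⟩
      induction i with
      | zero => simp
      | succ i ih => rw [pow_succ, ih (Nat.succ_pos i), hidem])
    hidem.le (fun b hb => by
      rw [← hspanB, ← span_coe_pow]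
      exact Submodule.subset_span hb)
    (Fintype.card n * (Fintype.card n * (m * g + 1))) (fun N => by
      rw [← pow_mul, hBpow]
      refine (Submodule.finrank_map_le _ _).trans
        ((Submodule.finrank_mono (pow_le_degreeLEMat hm _)).trans
          ((finrank_degreeLEMat_le _).trans ?_))
      have h2 : m * (g * N) + 1 ≤ (m * g + 1) * (N + 1) := by nlinarith
      rw [mul_assoc (Fintype.card n), mul_assoc (Fintype.card n)]
      exact Nat.mul_le_mul_left _ (Nat.mul_le_mul_left _ h2))
  refine ⟨r, fun N₀ => ?_⟩
  obtain ⟨N, hN, G, hGfin, hGr, hle⟩ := hr N₀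
  refine ⟨g * N, hN.trans (Nat.le_mul_of_pos_left N hg1), ?_⟩
  have hfinM : FiniteDimensional F (mixedPow B D (g * N)) :=
    Submodule.finiteDimensional_of_le (mixedPow_le hDB _)
  have hle' : B ^ (g * N) ≤ mixedPow B D (g * N) ⊔ G := by
    rw [pow_mul]
    exact hle.trans (sup_le_sup (mixedPow_pow_le g N) le_rfl)
  have hdim := (Submodule.finrank_mono hle').trans
    (Submodule.finrank_add_le_finrank_add_finrank _ _)
  rw [hBpow, hB, hD, ← map_mixedPow, ← (Submodule.equivMapOfInjective _ hφ _).finrank_eq,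
    ← (Submodule.equivMapOfInjective _ hφ _).finrank_eq] at hdim
  omega

end

/-! ### Monomials of the free algebra. -/

section Words

variable (F : Type*) [Field F]

/-- The monomial of a word. -/
def mono (w : List Gen) : Free F := (w.map (FreeAlgebra.ι F)).prod

theorem mono_append (u w : List Gen) : mono F (u ++ w) = mono F u * mono F w := by
  simp [mono]

theorem mono_cons (g : Gen) (w : List Gen) : mono F (g :: w) = FreeAlgebra.ι F g * mono F w := by
  simp [mono]

/-- The monomials form a basis. -/
noncomputable def monoBasis : Module.Basis (List Gen) F (Free F) :=
  (FreeAlgebra.basisFreeMonoid F Gen).reindex FreeMonoid.toList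

theorem monoBasis_apply (w : List Gen) : monoBasis F w = mono F w := by
  have h : FreeAlgebra.equivMonoidAlgebraFreeMonoid (mono F w) =
      MonoidAlgebra.single (FreeMonoid.ofList w) (1 : F) := by
    induction w with
    | nil => simp [mono, MonoidAlgebra.one_def]
    | cons g w ih =>
      rw [mono_cons, map_mul, ih]
      simp [FreeAlgebra.equivMonoidAlgebraFreeMonoid, MonoidAlgebra.single_mul_single]
  simp [monoBasis, FreeAlgebra.basisFreeMonoid]
  rw [← h, AlgEquiv.symm_apply_apply]

/-- The weight of a word. -/
def wordWeight (w : List Gen) : ℕ := (w.map Gen.weight).sum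

theorem linearIndependent_mono : LinearIndependent F (mono F) := by
  have := (monoBasis F).linearIndependent
  rwa [show ⇑(monoBasis F) = mono F from funext (monoBasis_apply F)] at this

theorem algA_le_span :
    (algA F).toSubmodule ≤ Submodule.span F (mono F '' {w | w.head? ≠ some Gen.x}) := by
  intro f hf
  refine NonUnitalAlgebra.adjoin_induction
    (p := fun f _ => f ∈ Submodule.span F (mono F '' {w | w.head? ≠ some Gen.x}))
    ?_ ?_ ?_ ?_ ?_ hf
  · rintro _ (⟨i, rfl⟩ | ⟨i, rfl⟩)
    · exact Submodule.subset_span ⟨Gen.a :: List.replicate i Gen.x, by simp,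
        by simp [mono, genA, genX]⟩
    · exact Submodule.subset_span ⟨Gen.b :: List.replicate i Gen.x, by simp,
        by simp [mono, genB, genX]⟩
  · exact fun _ _ _ _ => Submodule.add_mem _
  · exact Submodule.zero_mem _
  · intro x y _ _ hx hy
    have h := Submodule.mul_mem_mul hx hy
    rw [Submodule.span_mul_span] at h
    refine Submodule.span_mono ?_ h
    rintro _ ⟨_, ⟨u, hu, rfl⟩, _, ⟨w, hw, rfl⟩, rfl⟩
    refine ⟨u ++ w, ?_, mono_append F u w⟩
    rcases u with _ | ⟨g, u⟩
    · exact hw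
    · exact hu
  · exact fun r _ _ => Submodule.smul_mem _ r

theorem homogeneousPart_eq_span (j : ℕ) :
    homogeneousPart F j = Submodule.span F (mono F '' {w | wordWeight w = j}) := by
  rw [homogeneousPart]
  congr 1
  ext y
  exact ⟨fun ⟨w, hw, h⟩ => ⟨w, hw, h.symm⟩, fun ⟨w, hw, h⟩ => ⟨w, hw, h.symm⟩⟩

/-- The span of the words of weight `j` that do not begin with `x`. -/
def reducedPart (j : ℕ) : Submodule F (Free F) :=
  Submodule.span F (mono F '' {w | w.head? ≠ some Gen.x ∧ wordWeight w = j})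

theorem algAStarPart_le_reducedPart (j : ℕ) : algAStarPart F j ≤ reducedPart F j := by
  rintro f ⟨hf, hfj⟩
  have h1 := algA_le_span F (algAStar_le_algA F hf)
  rw [SetLike.mem_coe, homogeneousPart_eq_span] at hfj
  rw [reducedPart]
  rw [← show ⇑(monoBasis F) = mono F from funext (monoBasis_apply F),
    Module.Basis.mem_span_image] at *
  exact fun w hw => ⟨h1 hw, hfj hw⟩

end Words

/-! ### Substitution of scalars for `x` that depend on the position. -/

section Substitution

variable {F : Type*} [Field F]

/-- The substitution `x ↦ s`. -/
def theta (s : F) : Free F →ₐ[F] Free F :=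
  FreeAlgebra.lift F (fun g : Gen => match g with
    | Gen.a => genA F
    | Gen.b => genB F
    | Gen.x => algebraMap F (Free F) s)

theorem theta_zero_eq_zero {f : Free F} (hf : f ∈ idealX F) : theta 0 f = 0 := by
  have : idealX F ≤ TwoSidedIdeal.ker (theta (0 : F)) := by
    rw [idealX, TwoSidedIdeal.span_le, Set.singleton_subset_iff, SetLike.mem_coe,
      TwoSidedIdeal.mem_ker]
    simp [theta, genX]
  exact (TwoSidedIdeal.mem_ker _).1 (this hf)

/-- The word with all letters `x` removed. -/
def strip (w : List Gen) : List Gen := w.filter fun g => match g with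
  | Gen.x => false
  | _ => true

/-- The number of letters `x` of a word. -/
def countX : List Gen → ℕ
  | [] => 0
  | Gen.x :: w => countX w + 1
  | Gen.a :: w => countX w
  | Gen.b :: w => countX w

theorem length_strip (w : List Gen) : (strip w).length = wordWeight w := by
  induction w with
  | nil => rfl
  | cons g w ih => cases g <;> simp_all [strip, wordWeight, Gen.weight, add_comm]

theorem theta_mono (s : F) (w : List Gen) :
    theta s (mono F w) = s ^ countX w • mono F (strip w) := by
  induction w with
  | nil => simp [mono, countX, strip]
  | cons g w ih =>
    rw [mono_cons, map_mul, ih]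
    cases g
    · simp [theta, countX, strip, mono_cons, genA]
    · simp [theta, countX, strip, mono_cons, genB]
    · rw [theta, FreeAlgebra.lift_ι_apply, ← Algebra.smul_def, smul_smul, countX, pow_succ']
      simp [strip]

open Classical in
/-- The polynomial in `s` that is the coefficient of the word `v` in `theta s f`. -/
noncomputable def wordCoeff (v : List Gen) : Free F →ₗ[F] F[X] :=
  (monoBasis F).constr F fun w => if strip w = v then X ^ countX w else 0

theorem wordCoeff_mono (v w : List Gen) :
    wordCoeff v (mono F w) = open Classical in if strip w = v then X ^ countX w else 0 := by
  rw [← monoBasis_apply, wordCoeff, Module.Basis.constr_basis]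

instance : Finite Gen := Finite.of_surjective (fun i : Fin 3 => ![Gen.a, Gen.b, Gen.x] i)
  fun g => by cases g; exacts [⟨0, rfl⟩, ⟨1, rfl⟩, ⟨2, rfl⟩]

noncomputable instance : Fintype Gen := Fintype.ofFinite Gen

theorem theta_eq_sum {j : ℕ} {f : Free F} (hf : f ∈ reducedPart F j) (s : F) :
    theta s f = ∑ v : List.Vector Gen j, (wordCoeff v.toList f).eval s • mono F v.toList := by
  induction hf using Submodule.span_induction with
  | mem f hf =>
    obtain ⟨w, ⟨-, hw⟩, rfl⟩ := hf
    rw [theta_mono]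
    refine Eq.trans ?_ (Finset.sum_eq_single
      (⟨strip w, (length_strip w).trans hw⟩ : List.Vector Gen j) ?_ ?_).symm
    · rw [List.Vector.toList_mk, wordCoeff_mono, if_pos rfl, eval_pow, eval_X]
    · intro v _ hv
      rw [wordCoeff_mono, if_neg, eval_zero, zero_smul]
      exact fun h => hv (List.Vector.eq _ _ h.symm)
    · exact fun h => absurd (Finset.mem_univ (α := List.Vector Gen j) _) h
  | zero => simp
  | add f g _ _ hf hg => simp [hf, hg, add_smul, Finset.sum_add_distrib]
  | smul c f _ hf => simp [hf, Finset.smul_sum, smul_smul]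

/-- The action of the free algebra on sequences in which `a` and `b` shift and `x` multiplies by a
sequence of scalars. -/
def shiftAction (σ : ℕ → F) : Free F →ₐ[F] Module.End F (ℕ → Free F) :=
  FreeAlgebra.lift F (fun g : Gen => match g with
    | Gen.a => { toFun := fun φ c => genA F * φ (c + 1)
                 map_add' := fun φ ψ => by ext c; simp [mul_add]
                 map_smul' := fun r φ => by ext c; simp }
    | Gen.b => { toFun := fun φ c => genB F * φ (c + 1)
                 map_add' := fun φ ψ => by ext c; simp [mul_add]
                 map_smul' := fun r φ => by ext c; simp }
    | Gen.x => { toFun := fun φ c => σ c • φ c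
                 map_add' := fun φ ψ => by ext c; simp
                 map_smul' := fun r φ => by ext c; exact smul_comm (σ c) r (φ c) })

theorem shiftAction_a (σ : ℕ → F) (φ : ℕ → Free F) (c : ℕ) :
    shiftAction σ (FreeAlgebra.ι F Gen.a) φ c = genA F * φ (c + 1) := by
  rw [shiftAction, FreeAlgebra.lift_ι_apply]
  rfl

theorem shiftAction_b (σ : ℕ → F) (φ : ℕ → Free F) (c : ℕ) :
    shiftAction σ (FreeAlgebra.ι F Gen.b) φ c = genB F * φ (c + 1) := by
  rw [shiftAction, FreeAlgebra.lift_ι_apply]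
  rfl

theorem shiftAction_x (σ : ℕ → F) (φ : ℕ → Free F) (c : ℕ) :
    shiftAction σ (FreeAlgebra.ι F Gen.x) φ c = σ c • φ c := by
  rw [shiftAction, FreeAlgebra.lift_ι_apply]
  rfl

theorem shiftAction_gamma (σ : ℕ → F) (t : F) (f : Free F) :
    shiftAction σ (gamma t f) = shiftAction (fun c => σ c + t) f := by
  rw [← AlgHom.comp_apply]
  congr 1
  ext g φ c
  simp only [Function.comp_apply, AlgHom.comp_apply]
  cases g
  · rw [gamma, FreeAlgebra.lift_ι_apply, shiftAction_a, ← shiftAction_a σ, genA]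
  · rw [gamma, FreeAlgebra.lift_ι_apply, shiftAction_b, ← shiftAction_b σ, genB]
  · rw [gamma, FreeAlgebra.lift_ι_apply, shiftAction_x]
    simp only [map_add, genX, AlgHom.commutes]
    rw [LinearMap.add_apply, Pi.add_apply, shiftAction_x, add_smul]
    rfl

/-- Only `x` reads `σ`, so elements of `R` act independently of `σ`. -/
theorem shiftAction_of_mem_algR (σ : ℕ → F) {f : Free F} (hf : f ∈ algR F) (g : Free F) :
    shiftAction σ f (fun _ => g) = fun _ => f * g := by
  induction hf using NonUnitalAlgebra.adjoin_induction generalizing g with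
  | mem f hf =>
    ext c
    rcases hf with rfl | rfl
    · exact shiftAction_a σ _ c
    · exact shiftAction_b σ _ c
  | add f f' _ _ hf hf' =>
    rw [map_add, LinearMap.add_apply, hf, hf']
    ext c
    simp [add_mul]
  | zero =>
    rw [map_zero]
    ext c
    simp
  | mul f f' _ _ hf hf' =>
    rw [map_mul, Module.End.mul_apply, hf', hf]
    simp [mul_assoc]
  | smul r f _ hf =>
    rw [map_smul, LinearMap.smul_apply, hf]
    ext c
    simp

theorem shiftAction_mono (σ : ℕ → F) (s : F) (φ : ℕ → Free F) (w : List Gen) (c : ℕ)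
    (h : ∀ i, c ≤ i → i ≤ c + wordWeight w → σ i = s) :
    shiftAction σ (mono F w) φ c = theta s (mono F w) * φ (c + wordWeight w) := by
  induction w generalizing c with
  | nil => simp [mono, wordWeight]
  | cons g w ih =>
    rw [mono_cons, map_mul, map_mul, Module.End.mul_apply, mul_assoc]
    have hw : wordWeight (g :: w) = g.weight + wordWeight w := by simp [wordWeight]
    rw [hw] at h ⊢
    cases g
    · rw [shiftAction_a, ih (c + 1) fun i h1 h2 => h i (by omega) (by simp only [Gen.weight]; omega)]
      simp [theta, genA, Gen.weight, add_assoc]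
    · rw [shiftAction_b, ih (c + 1) fun i h1 h2 => h i (by omega) (by simp only [Gen.weight]; omega)]
      simp [theta, genB, Gen.weight, add_assoc]
    · rw [shiftAction_x, ih c fun i h1 h2 => h i (by omega) (by simp only [Gen.weight]; omega),
        h c le_rfl (by omega)]
      simp [theta, Gen.weight, Algebra.smul_def]

/-- A word that does not begin with `x` never reads `σ c`, only `σ` at `c + 1, …, c + j`.
Consecutive factors thus read disjoint blocks and can be given independent scalars. -/
theorem shiftAction_of_mem_reducedPart {σ : ℕ → F} {s : F} {j c : ℕ}
    (h : ∀ i, c < i → i ≤ c + j → σ i = s) (φ : ℕ → Free F) {f : Free F}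
    (hf : f ∈ reducedPart F j) : shiftAction σ f φ c = theta s f * φ (c + j) := by
  induction hf using Submodule.span_induction with
  | mem f hf =>
    obtain ⟨w, ⟨hw, rfl⟩, rfl⟩ := hf
    rcases w with _ | ⟨g, w⟩
    · simp [mono, wordWeight]
    have hg : wordWeight (g :: w) = g.weight + wordWeight w := by simp [wordWeight]
    rw [hg] at h ⊢
    rw [mono_cons, map_mul, map_mul, Module.End.mul_apply, mul_assoc]
    cases g
    · rw [shiftAction_a, shiftAction_mono σ s φ w (c + 1) fun i h1 h2 =>
        h i (by omega) (by simp only [Gen.weight]; omega)]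
      simp [theta, genA, Gen.weight, add_assoc]
    · rw [shiftAction_b, shiftAction_mono σ s φ w (c + 1) fun i h1 h2 =>
        h i (by omega) (by simp only [Gen.weight]; omega)]
      simp [theta, genB, Gen.weight, add_assoc]
    · simp at hw
  | zero => simp
  | add f g _ _ hf hg => rw [map_add, LinearMap.add_apply, Pi.add_apply, hf, hg, map_add, add_mul]
  | smul r f _ hf =>
    rw [map_smul, LinearMap.smul_apply, Pi.smul_apply, hf, map_smul, smul_mul_assoc]

end Substitution

/-! ### Products of shifted matrices. -/

section Products

variable {F : Type*} [Field F] {n : Type*} [Fintype n] [DecidableEq n] {ι : Type*}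

/-- The product of the matrices `p (W i)` shifted by `s i`. -/
noncomputable def shiftProd (p : ι → Matrix n n F[X]) :
    (ℕ → F) → (N : ℕ) → (Fin N → ι) → Matrix n n F[X]
  | _, 0, _ => 1
  | s, N + 1, W => shiftMat (s 0) (p (W 0)) * shiftProd p (fun i => s (i + 1)) N (Fin.tail W)

variable (p : ι → Matrix n n F[X])

theorem shiftMat_mul_shiftProd (a : F) (v : ι) (s : ℕ → F) (N : ℕ) (W : Fin N → ι) :
    shiftMat a (p v) * shiftProd p s N W =
      shiftProd p (fun i => Nat.casesOn i a s) (N + 1) (Fin.cons v W) := by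
  simp [shiftProd]

theorem shiftProd_mem (s : ℕ → F) (N : ℕ) (W : Fin N → ι) :
    shiftProd p s N W ∈ shiftSpan p ^ N := by
  induction N generalizing s with
  | zero => exact Submodule.one_le.1 le_rfl
  | succ N ih =>
    rw [pow_succ']
    exact Submodule.mul_mem_mul (Submodule.subset_span ⟨(s 0, W 0), rfl⟩) (ih _ _)

theorem shiftSpan_pow_le (N : ℕ) : shiftSpan p ^ N ≤
    Submodule.span F (Set.range fun q : (ℕ → F) × (Fin N → ι) => shiftProd p q.1 N q.2) := by
  induction N with
  | zero =>
    rw [pow_zero, Submodule.one_le]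
    exact Submodule.subset_span ⟨(fun _ => 0, Fin.elim0), rfl⟩
  | succ N ih =>
    rw [pow_succ']
    refine (mul_le_mul_right ih _).trans ?_
    rw [shiftSpan, Submodule.span_mul_span, Submodule.span_le]
    rintro _ ⟨_, ⟨⟨a, v⟩, rfl⟩, _, ⟨⟨s, W⟩, rfl⟩, rfl⟩
    exact Submodule.subset_span ⟨(_, _), (shiftMat_mul_shiftProd p a v s N W).symm⟩

/-- A product with one factor in `D` is a difference of two products that share their indices and
differ in one shift. -/
theorem mixedPow_le_span (N : ℕ) : mixedPow (shiftSpan p) (shiftDiffSpan p) N ≤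
    Submodule.span F (Set.range fun q : (ℕ → F) × (ℕ → F) × (Fin N → ι) =>
      shiftProd p q.1 N q.2.2 - shiftProd p q.2.1 N q.2.2) := by
  induction N with
  | zero => exact bot_le
  | succ N ih =>
    rw [mixedPow]
    refine sup_le ((mul_le_mul_right ih _).trans ?_)
      ((mul_le_mul_right (shiftSpan_pow_le p N) _).trans ?_)
    · rw [shiftSpan, Submodule.span_mul_span, Submodule.span_le]
      rintro _ ⟨_, ⟨⟨a, v⟩, rfl⟩, _, ⟨⟨s, s', W⟩, rfl⟩, rfl⟩
      dsimp only
      rw [mul_sub, shiftMat_mul_shiftProd, shiftMat_mul_shiftProd]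
      exact Submodule.subset_span ⟨(_, _, _), rfl⟩
    · rw [shiftDiffSpan, Submodule.span_mul_span, Submodule.span_le]
      rintro _ ⟨_, ⟨⟨a, a', v⟩, rfl⟩, _, ⟨⟨s, W⟩, rfl⟩, rfl⟩
      dsimp only
      rw [sub_mul, shiftMat_mul_shiftProd, shiftMat_mul_shiftProd]
      exact Submodule.subset_span ⟨(_, _, _), rfl⟩

theorem eval_shiftProd_succ (t : F) (s : ℕ → F) (N : ℕ) (W : Fin (N + 1) → ι) :
    (shiftProd p s (N + 1) W).map (eval t) = (p (W 0)).map (eval (t + s 0)) *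
      (shiftProd p (fun i => s (i + 1)) N (Fin.tail W)).map (eval t) := by
  have h := map_mul (evalRingHom t).mapMatrix (shiftMat (s 0) (p (W 0)))
    (shiftProd p (fun i => s (i + 1)) N (Fin.tail W))
  refine h.trans ?_
  congr 1
  ext a b
  change eval t ((p (W 0) a b).comp (X + C (s 0))) = eval (t + s 0) (p (W 0) a b)
  rw [eval_comp, eval_add, eval_X, eval_C]

theorem span_eval_pow_eq_bot {N : ℕ}
    (h : ∀ W : Fin N → ι, (shiftProd p (fun _ => 0) N W).map (eval 0) = 0) :
    Submodule.span F (Set.range fun v => (p v).map (eval 0)) ^ N = ⊥ := by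
  have key : ∀ N, Submodule.span F (Set.range fun v => (p v).map (eval 0)) ^ N ≤
      Submodule.span F (Set.range fun W : Fin N → ι =>
        (shiftProd p (fun _ => 0) N W).map (eval 0)) := by
    intro N
    induction N with
    | zero =>
      rw [pow_zero, Submodule.one_le]
      refine Submodule.subset_span ⟨Fin.elim0, ?_⟩
      exact map_one (evalRingHom (0 : F)).mapMatrix
    | succ N ih =>
      rw [pow_succ']
      refine (mul_le_mul_right ih _).trans ?_
      rw [Submodule.span_mul_span, Submodule.span_le]
      rintro _ ⟨_, ⟨v, rfl⟩, _, ⟨W, rfl⟩, rfl⟩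
      refine Submodule.subset_span ⟨Fin.cons v W, ?_⟩
      simp [eval_shiftProd_succ]
  rw [eq_bot_iff]
  refine (key N).trans ?_
  rw [Submodule.span_le]
  rintro _ ⟨W, rfl⟩
  exact h W

end Products

/-! ### Expansion of the powers of `M` in concatenated words. -/

section Expansion

variable {F : Type*} [Field F] {j : ℕ}

/-- The concatenation of the words of a family. -/
def concatWords : (N : ℕ) → (Fin N → List.Vector Gen j) → List Gen
  | 0, _ => []
  | N + 1, W => (W 0).toList ++ concatWords N (Fin.tail W)

theorem concatWords_injective (N : ℕ) : Function.Injective (concatWords (j := j) N) := by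
  induction N with
  | zero => exact fun _ _ _ => Subsingleton.elim _ _
  | succ N ih =>
    intro W W' h
    obtain ⟨h1, h2⟩ := List.append_inj h (by simp)
    rw [← Fin.cons_self_tail W, ← Fin.cons_self_tail W', List.Vector.eq _ _ h1, ih h2]

variable {d : ℕ}

/-- The matrix of coefficients of the word `v` in the entries of a matrix after the substitution of
a scalar for `x`. -/
noncomputable def coeffFamily (M : Matrix (Fin d) (Fin d) (Free F)) (v : List.Vector Gen j) :
    Matrix (Fin d) (Fin d) F[X] :=
  M.map (wordCoeff v.toList)

/-- The product of the matrices obtained from `M` by the substitutions `x ↦ s i`. -/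
def thetaProd (M : Matrix (Fin d) (Fin d) (Free F)) : (ℕ → F) → ℕ → Matrix (Fin d) (Fin d) (Free F)
  | _, 0 => 1
  | s, N + 1 => M.map (theta (s 0)) * thetaProd M (fun i => s (i + 1)) N

/-- The scalar `t` common to all factors will come from `gamma t`. It enters only through evaluation
at `t`, a functional that does not involve `s`. -/
theorem thetaProd_apply {M : Matrix (Fin d) (Fin d) (Free F)}
    (hM : ∀ k l, M k l ∈ reducedPart F j) (t : F) (s : ℕ → F) (N : ℕ) (k l : Fin d) :
    thetaProd M (fun i => t + s i) N k l = ∑ W : Fin N → List.Vector Gen j,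
      (shiftProd (coeffFamily M) s N W k l).eval t • mono F (concatWords N W) := by
  induction N generalizing s k with
  | zero =>
    rw [Fintype.sum_unique]
    by_cases h : k = l <;> simp [thetaProd, shiftProd, concatWords, mono, Matrix.one_apply, h]
  | succ N ih =>
    rw [thetaProd, Matrix.mul_apply, ← (Fin.consEquiv fun _ => List.Vector Gen j).sum_comp,
      Fintype.sum_prod_type]
    have h1 : ∀ v (W : Fin N → List.Vector Gen j),
        (shiftProd (coeffFamily M) s (N + 1) (Fin.cons v W) k l).eval t =
        ∑ q, (wordCoeff v.toList (M k q)).eval (t + s 0) *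
          (shiftProd (coeffFamily M) (fun i => s (i + 1)) N W q l).eval t := by
      intro v W
      have := congrFun (congrFun (eval_shiftProd_succ (coeffFamily M) t s N (Fin.cons v W)) k) l
      rw [Matrix.mul_apply] at this
      exact this
    have h2 : ∀ q, (M.map (theta (t + s 0))) k q *
        thetaProd M (fun i => t + s (i + 1)) N q l =
        ∑ v : List.Vector Gen j, ∑ W : Fin N → List.Vector Gen j,
          ((wordCoeff v.toList (M k q)).eval (t + s 0) *
            (shiftProd (coeffFamily M) (fun i => s (i + 1)) N W q l).eval t) •
            mono F (concatWords (N + 1) (Fin.cons v W)) := by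
      intro q
      rw [Matrix.map_apply, theta_eq_sum (hM k q), ih, Finset.sum_mul_sum]
      refine Finset.sum_congr rfl fun v _ => Finset.sum_congr rfl fun W _ => ?_
      rw [smul_mul_smul_comm, ← mono_append, concatWords]
      rfl
    rw [Finset.sum_congr rfl fun q _ => h2 q, Finset.sum_comm]
    refine Finset.sum_congr rfl fun v _ => ?_
    rw [Finset.sum_comm]
    refine Finset.sum_congr rfl fun W _ => ?_
    rw [← Finset.sum_smul, ← h1]
    rfl

/-- The sequence that is `s i` on the positions `i * j + 1, …, (i + 1) * j`. -/
def blockSeq (j : ℕ) (s : ℕ → F) (c : ℕ) : F := s ((c - 1) / j)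

theorem shiftAction_pow {M : Matrix (Fin d) (Fin d) (Free F)}
    (hM : ∀ k l, M k l ∈ reducedPart F j) (s : ℕ → F) (φ : ℕ → Free F) (N i : ℕ) (k l : Fin d) :
    shiftAction (blockSeq j s) ((M ^ N) k l) φ (i * j) =
      thetaProd M (fun i' => s (i + i')) N k l * φ ((i + N) * j) := by
  induction N generalizing i k with
  | zero => by_cases h : k = l <;> simp [thetaProd, Matrix.one_apply, h]
  | succ N ih =>
    rw [pow_succ', thetaProd, Matrix.mul_apply, Matrix.mul_apply, map_sum, LinearMap.sum_apply,
      Finset.sum_apply, Finset.sum_mul]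
    refine Finset.sum_congr rfl fun q _ => ?_
    rw [map_mul, Module.End.mul_apply, shiftAction_of_mem_reducedPart (s := s i) ?_ _ (hM k q)]
    · have := ih (i + 1) q
      rw [add_mul, one_mul] at this
      rw [this, Matrix.map_apply, mul_assoc]
      simp only [add_zero, add_assoc, add_comm 1]
    · intro c h1 h2
      have hj : 0 < j := by omega
      rw [blockSeq, Nat.div_eq_of_lt_le (k := i) (by omega) (by rw [Nat.succ_mul]; omega)]

end Expansion

/-! ### The dimension bound by duality. -/

section Bound

variable {F : Type*} [Field F] {d j : ℕ}

theorem exists_functional_of_mem_entrySpan {M : Matrix (Fin d) (Fin d) (Free F)}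
    (hM : ∀ k l, M k l ∈ reducedPart F j) {N : ℕ} {f : Free F}
    (hf : f ∈ entrySpan (matrixL (M ^ N))) :
    ∃ L : Matrix (Fin d) (Fin d) F[X] →ₗ[F] F, ∀ s : ℕ → F,
      shiftAction (blockSeq j s) f (fun _ => 1) 0 = ∑ W : Fin N → List.Vector Gen j,
        L (shiftProd (coeffFamily M) s N W) • mono F (concatWords N W) := by
  -- The functional must be chosen before `s`. Elements admitting one form a subspace, so it is
  -- enough to treat the entries of `gamma t` applied to `M ^ N`.
  let V : Submodule F (Free F) :=
    { carrier := {f | ∃ L : Matrix (Fin d) (Fin d) F[X] →ₗ[F] F, ∀ s : ℕ → F,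
        shiftAction (blockSeq j s) f (fun _ => 1) 0 = ∑ W : Fin N → List.Vector Gen j,
          L (shiftProd (coeffFamily M) s N W) • mono F (concatWords N W)}
      zero_mem' := ⟨0, fun s => by simp⟩
      add_mem' := by
        rintro f g ⟨L, hL⟩ ⟨L', hL'⟩
        refine ⟨L + L', fun s => ?_⟩
        rw [map_add, LinearMap.add_apply, Pi.add_apply, hL, hL']
        simp [add_smul, Finset.sum_add_distrib]
      smul_mem' := by
        rintro c f ⟨L, hL⟩
        refine ⟨c • L, fun s => ?_⟩
        rw [map_smul, LinearMap.smul_apply, Pi.smul_apply, hL]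
        simp [Finset.smul_sum, smul_smul] }
  have hgen : ∀ (t : F) k l, ((M ^ N).map (gamma t)) k l ∈ V := by
    intro t k l
    refine ⟨{ toFun := fun A => (A k l).eval t
              map_add' := fun A B => by simp
              map_smul' := fun c A => by simp }, fun s => ?_⟩
    rw [Matrix.map_apply, shiftAction_gamma]
    have h := shiftAction_pow hM (fun i => t + s i) (fun _ => 1) N 0 k l
    rw [zero_mul, mul_one] at h
    have h2 : (fun c => blockSeq j s c + t) = blockSeq j (fun i => t + s i) := by
      ext c
      exact add_comm _ _
    rw [h2, h]
    simp only [zero_add]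
    exact thetaProd_apply hM t s N k l
  have hmat : ∀ A ∈ matrixL (M ^ N), ∀ k l, A k l ∈ V := by
    intro A hA k l
    induction hA using Submodule.span_induction with
    | mem A hA =>
      obtain ⟨t, rfl⟩ := hA
      exact hgen t k l
    | zero => exact V.zero_mem
    | add A B _ _ hA hB => exact V.add_mem hA hB
    | smul c A _ hA => exact V.smul_mem c hA
  have hle : entrySpan (matrixL (M ^ N)) ≤ V := by
    rw [entrySpan, Submodule.span_le]
    rintro _ ⟨A, hA, k, l, rfl⟩
    exact hmat A hA k l
  exact hle hf

theorem exists_annihilating_functional {M : Matrix (Fin d) (Fin d) (Free F)}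
    (hM : ∀ k l, M k l ∈ reducedPart F j) {N : ℕ} {f : Free F} (hfR : f ∈ algR F)
    (hf : f ∈ entrySpan (matrixL (M ^ N))) :
    ∃ L : Matrix (Fin d) (Fin d) F[X] →ₗ[F] F,
      (∀ A ∈ mixedPow (shiftSpan (coeffFamily (j := j) M)) (shiftDiffSpan (coeffFamily (j := j) M)) N,
        L A = 0) ∧
      f = ∑ W : Fin N → List.Vector Gen j,
        L (shiftProd (coeffFamily M) (fun _ => 0) N W) • mono F (concatWords N W) := by
  obtain ⟨L, hL⟩ := exists_functional_of_mem_entrySpan hM hf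
  -- The left-hand side does not depend on `s`; by independence of the concatenated words, neither
  -- does any coefficient.
  have hfs : ∀ s : ℕ → F, f = ∑ W : Fin N → List.Vector Gen j,
      L (shiftProd (coeffFamily M) s N W) • mono F (concatWords N W) := by
    intro s
    rw [← hL, shiftAction_of_mem_algR _ hfR, mul_one]
  have hind : LinearIndependent F
      fun W : Fin N → List.Vector Gen j => mono F (concatWords N W) :=
    (linearIndependent_mono F).comp _ (concatWords_injective N)
  refine ⟨L, ?_, hfs _⟩
  suffices h : mixedPow (shiftSpan (coeffFamily (j := j) M)) (shiftDiffSpan (coeffFamily (j := j) M)) N ≤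
      LinearMap.ker L from fun A hA => h hA
  refine (mixedPow_le_span _ N).trans ?_
  rw [Submodule.span_le]
  rintro _ ⟨⟨s, s', W⟩, rfl⟩
  have h0 : ∑ W : Fin N → List.Vector Gen j, (L (shiftProd (coeffFamily M) s N W) -
      L (shiftProd (coeffFamily M) s' N W)) • mono F (concatWords N W) = 0 := by
    simp only [sub_smul, Finset.sum_sub_distrib]
    rw [← hfs s, ← hfs s', sub_self]
  have := Fintype.linearIndependent_iff.1 hind _ h0 W
  rwa [← map_sub] at this

/-- The dimension of `R ∩ S(L(M ^ N))` is at most the codimension of `mixedPow`. -/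
theorem finrank_inf_entrySpan_le {M : Matrix (Fin d) (Fin d) (Free F)}
    (hM : ∀ k l, M k l ∈ reducedPart F j) (N : ℕ) :
    FiniteDimensional F ↥((algR F).toSubmodule ⊓ entrySpan (matrixL (M ^ N))) ∧
      Module.finrank F ↥((algR F).toSubmodule ⊓ entrySpan (matrixL (M ^ N))) +
        Module.finrank F
          (mixedPow (shiftSpan (coeffFamily (j := j) M)) (shiftDiffSpan (coeffFamily (j := j) M)) N) ≤
      Module.finrank F ↥(shiftSpan (coeffFamily (j := j) M) ^ N) := by
  set p := coeffFamily (j := j) M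
  obtain ⟨m, -, hm⟩ := exists_shiftSpan_le_degreeLEMat p
  have hfin : FiniteDimensional F ↥(shiftSpan p ^ N) :=
    Submodule.finiteDimensional_of_le (pow_le_degreeLEMat hm N)
  set Q := (mixedPow (shiftSpan p) (shiftDiffSpan p) N).comap (shiftSpan p ^ N).subtype with hQ
  -- The space to be bounded lies in the image under `Ψ` of the annihilator of `mixedPow`, whose
  -- dimension is the codimension of `mixedPow`.
  let Ψ : Module.Dual F ↥(shiftSpan p ^ N) →ₗ[F] Free F :=
    { toFun := fun μ => ∑ W : Fin N → List.Vector Gen j,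
        μ ⟨shiftProd p (fun _ => 0) N W, shiftProd_mem p _ N W⟩ • mono F (concatWords N W)
      map_add' := fun μ ν => by simp [add_smul, Finset.sum_add_distrib]
      map_smul' := fun c μ => by simp [Finset.smul_sum, smul_smul] }
  have hle : (algR F).toSubmodule ⊓ entrySpan (matrixL (M ^ N)) ≤ Q.dualAnnihilator.map Ψ := by
    rintro f ⟨hfR, hf⟩
    obtain ⟨L, hL, hfL⟩ := exists_annihilating_functional hM hfR hf
    refine ⟨L ∘ₗ (shiftSpan p ^ N).subtype, ?_, hfL.symm⟩
    rw [SetLike.mem_coe, Submodule.mem_dualAnnihilator]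
    exact fun A hA => hL A.1 hA
  refine ⟨Submodule.finiteDimensional_of_le hle, ?_⟩
  have h1 := (Submodule.finrank_mono hle).trans (Submodule.finrank_map_le _ _)
  have h2 := Subspace.finrank_add_finrank_dualAnnihilator_eq Q
  rw [hQ, (Submodule.comapSubtypeEquivOfLe
    (mixedPow_le (shiftDiffSpan_le p) N)).finrank_eq, ← hQ] at h2
  omega

/-- These are the coefficients of independent words in the entries of `M ^ N` at `x = 0`, which
vanish because the entries lie in `⟨x⟩`. -/
theorem eval_shiftProd_eq_zero {M : Matrix (Fin d) (Fin d) (Free F)}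
    (hM : ∀ k l, M k l ∈ reducedPart F j) {N : ℕ} (hN : ∀ k l, (M ^ N) k l ∈ idealX F)
    (W : Fin N → List.Vector Gen j) :
    (shiftProd (coeffFamily M) (fun _ => 0) N W).map (eval 0) = 0 := by
  have hpow : ∀ N, thetaProd M (fun _ => (0 : F)) N = (M ^ N).map (theta 0) := by
    intro N
    induction N with
    | zero => exact (map_one (theta (0 : F)).mapMatrix).symm
    | succ N ih =>
      rw [thetaProd, ih, pow_succ']
      exact (map_mul (theta (0 : F)).mapMatrix _ _).symm
  ext k l
  have h := thetaProd_apply hM 0 (fun _ => 0) N k l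
  simp only [add_zero] at h
  rw [hpow, Matrix.map_apply, theta_zero_eq_zero (hN k l)] at h
  exact Fintype.linearIndependent_iff.1
    ((linearIndependent_mono F).comp _ (concatWords_injective N)) _ h.symm W

end Bound

end PlatinumAlgebra

theorem mainTheorem4 (K : Type*) [Field K] [Finite K] (F : Type*) [Field F] [Algebra K F]
    [IsAlgClosure K F] (d j : ℕ)
    (M : Matrix (Fin d) (Fin d) (PlatinumAlgebra.Free F))
    (hM : ∀ k l : Fin d, M k l ∈ PlatinumAlgebra.algAStarPart F j)
    (hx : ∀ᶠ α : ℕ in Filter.cofinite,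
      ∀ k l : Fin d, (M ^ α) k l ∈ PlatinumAlgebra.idealX F) :
    {n : ℕ |
      FiniteDimensional F
        ↥((PlatinumAlgebra.algR F).toSubmodule ⊓
          PlatinumAlgebra.entrySpan (PlatinumAlgebra.matrixL (M ^ n))) ∧
      (Module.finrank F
        ↥((PlatinumAlgebra.algR F).toSubmodule ⊓
          PlatinumAlgebra.entrySpan (PlatinumAlgebra.matrixL (M ^ n))) : ℝ) ≤ √(n : ℝ)}.Infinite := by
  have hclosed : IsAlgClosed F := IsAlgClosure.isAlgClosed K
  have halg : Algebra.IsAlgebraic K F := IsAlgClosure.isAlgebraic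
  have hinf : Infinite F := inferInstance
  have hM' : ∀ k l, M k l ∈ PlatinumAlgebra.reducedPart F j := fun k l =>
    PlatinumAlgebra.algAStarPart_le_reducedPart F j (hM k l)
  obtain ⟨α, hα⟩ := hx.exists
  obtain ⟨r, hr⟩ := PlatinumAlgebra.exists_bounded_codim_shiftSpan K
    (PlatinumAlgebra.coeffFamily (j := j) M)
    (PlatinumAlgebra.span_eval_pow_eq_bot _ (PlatinumAlgebra.eval_shiftProd_eq_zero hM' hα))
  rw [Set.infinite_iff_exists_gt]
  intro N₀
  -- `N₀ + 1` makes `N` exceed `N₀` strictly, and `r ^ 2` gives `r ≤ √N`.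
  obtain ⟨N, hN, hle⟩ := hr (max (N₀ + 1) (r ^ 2))
  obtain ⟨hfin, hdim⟩ := PlatinumAlgebra.finrank_inf_entrySpan_le hM' N
  refine ⟨N, ⟨hfin, ?_⟩, by omega⟩
  refine Real.le_sqrt_of_sq_le ?_
  have h1 : Module.finrank F
      ↥((PlatinumAlgebra.algR F).toSubmodule ⊓
        PlatinumAlgebra.entrySpan (PlatinumAlgebra.matrixL (M ^ N))) ≤ r := by omega
  exact_mod_cast (Nat.pow_le_pow_left h1 2).trans ((le_max_right _ _).trans hN)
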